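/- Let $\mathbb{H}=\{(z_1,z_2)\in\mathbb{C}^2 : |z_2|<|z_1|<1\}$ be the Hartogs triangle, let $dV$ be Lebesgue measure on $\mathbb{C}^2$, let $\delta_1(z_1,z_2)=|z_1|$, and let $\mathbf{B}_{\mathbb{H}}$ be the Bergman projection of $\mathbb{H}$, i.e. the orthogonal projection of $L^2(\mathbb{H})$ onto the closed subspace $A^2(\mathbb{H})$ of square-integrable holomorphic functions. For a real number $p\ge 2$ let $A^p(\mathbb{H},\delta_1^{p-2})$ be the space of holomorphic functions $g$ on $\mathbb{H}$ with $$\|g\|_{L^p(\mathbb{H},\delta_1^{p-2})}^p=\int_{\mathbb{H}}|g|^p\,\delta_1^{p-2}\,dV<\infty .$$ **Theorem.** For every real $p$ with $2\le p<\infty$, the map $\mathbf{B}_{\mathbb{H}}$ is bounded and surjective from $L^p(\mathbb{H})\subset L^2(\mathbb{H})$ to $A^p(\mathbb{H},\delta_1^{p-2})$. That is, there is a constant $C$, depending only on $p$, such that for every $f\in L^p(\mathbb{H})$ one has $\mathbf{B}_{\mathbb{H}}f\in A^p(\mathbb{H},\delta_1^{p-2})$ and $$\|\mathbf{B}_{\mathbb{H}}f\|_{L^p(\mathbb{H},\delta_1^{p-2})}\le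 C\,\|f\|_{L^p(\mathbb{H})},$$ and for every $g\in A^p(\mathbb{H},\delta_1^{p-2})$ there is $f\in L^p(\mathbb{H})$ with $\mathbf{B}_{\mathbb{H}}f=g$. -/

import Mathlib

open MeasureTheory Set Filter Topology Metric
open scoped ENNReal NNReal

/-- The Hartogs triangle `{(z₁, z₂) ∈ ℂ² : |z₂| < |z₁| < 1}`. -/
def hartogsTriangle : Set (ℂ × ℂ) := {z | ‖z.2‖ < ‖z.1‖ ∧ ‖z.1‖ < 1}

/-- The function `δ₁(z₁, z₂) = |z₁|` on `ℂ²`. -/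
noncomputable def delta1 (z : ℂ × ℂ) : ℝ := ‖z.1‖

/-- The norm `(∫_U |f|^p ω dV)^(1/p)` of the weighted space `L^p(U, ω)`, where `dV` is Lebesgue
measure of `ℂ²`; its value is `∞` when the integral diverges. -/
noncomputable def weightedLpNorm (U : Set (ℂ × ℂ)) (p : ℝ) (ω : ℂ × ℂ → ℝ) (f : ℂ × ℂ → ℂ) :
    ℝ≥0∞ :=
  (∫⁻ z in U, ‖f z‖ₑ ^ p * ENNReal.ofReal (ω z)) ^ (1 / p)

/-- The weighted Bergman space `A^p(U, ω)`: the functions that are holomorphic on `U` and have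
finite norm in `L^p(U, ω)`. Only the values of a function on `U` matter. -/
def weightedBergmanSpace (U : Set (ℂ × ℂ)) (p : ℝ) (ω : ℂ × ℂ → ℝ) : Set (ℂ × ℂ → ℂ) :=
  {f | DifferentiableOn ℂ f U ∧ weightedLpNorm U p ω f < ∞}

/-- The Bergman space `A²(U)`, as the subspace of `L²(U)` of the classes that have a
representative which is holomorphic on `U`. -/
noncomputable def bergmanSpace (U : Set (ℂ × ℂ)) : Submodule ℂ (Lp ℂ 2 (volume.restrict U)) where
  carrier := {f | ∃ g : ℂ × ℂ → ℂ, DifferentiableOn ℂ g U ∧ f =ᵐ[volume.restrict U] g}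
  add_mem' := by
    rintro f₁ f₂ ⟨g₁, h₁, e₁⟩ ⟨g₂, h₂, e₂⟩
    exact ⟨g₁ + g₂, h₁.add h₂, (Lp.coeFn_add f₁ f₂).trans (e₁.add e₂)⟩
  zero_mem' := ⟨0, differentiableOn_const 0, Lp.coeFn_zero ℂ 2 _⟩
  smul_mem' := by
    rintro c f ⟨g, h, e⟩
    exact ⟨c • g, h.const_smul c, (Lp.coeFn_smul c f).trans (e.const_smul c)⟩

/-- Mean value inequality for `|f|²` over a ball, for `f` holomorphic on the ball. -/
theorem bergman_mean_value {f : ℂ × ℂ → ℂ} {c : ℂ × ℂ} {r : ℝ}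
    (hf : DifferentiableOn ℂ f (ball c r)) :
    ‖f c‖ₑ ^ 2 * volume (ball (0 : ℂ × ℂ) r) ≤ ∫⁻ z in ball c r, ‖f z‖ₑ ^ 2 := by
  set F : ℂ × ℂ → ℝ≥0∞ := (ball (0 : ℂ × ℂ) r).indicator (fun z => ‖f (c + z)‖ₑ ^ 2) with hF
  have hmaps : MapsTo (fun z : ℂ × ℂ => c + z) (ball 0 r) (ball c r) := by
    intro z hz; simpa [mem_ball_iff_norm] using hz
  have hFm : Measurable F := by
    have h1 : ContinuousOn (fun z => ‖f (c + z)‖ₑ ^ 2) (ball (0 : ℂ × ℂ) r) := by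
      have : ContinuousOn (fun z => f (c + z)) (ball (0 : ℂ × ℂ) r) :=
        hf.continuousOn.comp (by fun_prop) hmaps
      exact (ENNReal.continuous_pow 2).comp_continuousOn this.enorm
    classical
    have := h1.measurable_piecewise (g := fun _ => (0 : ℝ≥0∞)) continuousOn_const
      measurableSet_ball
    rw [hF, ← Set.piecewise_eq_indicator]
    exact this
  have hFint : ∫⁻ z, F z = ∫⁻ z in ball c r, ‖f z‖ₑ ^ 2 := by
    rw [hF, lintegral_indicator measurableSet_ball]
    have : (volume : Measure (ℂ × ℂ)).IsAddLeftInvariant :=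
      inferInstanceAs (((volume : Measure ℂ).prod volume).IsAddLeftInvariant)
    have := (measurePreserving_add_left (volume : Measure (ℂ × ℂ)) c).setLIntegral_comp_preimage_emb
      (measurableEmbedding_addLeft c) (fun z => ‖f z‖ₑ ^ 2) (ball c r)
    rw [← this]
    congr 2
    ext z; simp
  set e : ℝ → ℂ := fun θ => circleMap 0 1 θ with he
  have hen : ∀ θ, ‖e θ‖ = 1 := by intro θ; simp [he]
  have hec : Continuous e := continuous_circleMap 0 1
  have hrot : ∀ θ, ∫⁻ z : ℂ × ℂ, F (e θ • z) = ∫⁻ z, F z := by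
    intro θ
    have h1 : MeasurePreserving (fun z : ℂ => e θ * z) :=
      (rotation ⟨e θ, by simp [Submonoid.unitSphere, hen]⟩).measurePreserving
    have h2 : MeasurePreserving (fun z : ℂ × ℂ => e θ • z)  :=
      h1.prod h1
    exact h2.lintegral_comp hFm
  have key : ∀ z ∈ ball (0 : ℂ × ℂ) r,
      ENNReal.ofReal (2 * Real.pi) * ‖f c‖ₑ ^ 2
        ≤ ∫⁻ θ in Ioc 0 (2 * Real.pi), F (e θ • z) := by
    intro z hz
    set g : ℂ → ℂ := fun l => f (c + l • z) ^ 2 with hg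
    have hmem : ∀ l : ℂ, ‖l‖ ≤ 1 → l • z ∈ ball (0 : ℂ × ℂ) r := by
      intro l hl
      rw [mem_ball_zero_iff] at hz ⊢
      rw [norm_smul]
      nlinarith [norm_nonneg z]
    have hgd : DifferentiableOn ℂ g (closedBall 0 1) := by
      refine DifferentiableOn.pow ?_ 2
      refine hf.comp (by fun_prop) ?_
      intro l hl
      exact hmaps (hmem l (by simpa using hl))
    have hcl : DiffContOnCl ℂ g (ball 0 |(1 : ℝ)|) := by
      have := hgd.diffContOnCl_ball (c := 0) (R := 1) subset_rfl
      simpa using this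
    have havg := hcl.circleAverage
    have h0 : g 0 = f c ^ 2 := by simp [hg]
    rw [h0, Real.circleAverage_def] at havg
    have h2 : ((2 * Real.pi : ℝ) : ℂ) * f c ^ 2
        = ∫ θ in Ioc 0 (2 * Real.pi), g (circleMap 0 1 θ) := by
      rw [← havg, intervalIntegral.integral_of_le (by positivity), Complex.real_smul, ← mul_assoc,
        ← Complex.ofReal_mul, mul_inv_cancel₀ (by positivity), Complex.ofReal_one, one_mul]
    have h3 : ENNReal.ofReal (2 * Real.pi) * ‖f c‖ₑ ^ 2
        = ‖((2 * Real.pi : ℝ) : ℂ) * f c ^ 2‖ₑ := by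
      rw [enorm_mul, enorm_pow, ← ofReal_norm (((2 * Real.pi : ℝ) : ℂ)), Complex.norm_real,
        Real.norm_of_nonneg (by positivity)]
    rw [h3, h2]
    refine (enorm_integral_le_lintegral_enorm _).trans (le_of_eq ?_)
    refine lintegral_congr fun θ => ?_
    have : e θ • z ∈ ball (0 : ℂ × ℂ) r := hmem _ (hen θ).le
    rw [hF, indicator_of_mem this, hg]
    simp only [enorm_pow, he]
  have hswap : ∫⁻ z in ball (0 : ℂ × ℂ) r, ∫⁻ θ in Ioc 0 (2 * Real.pi), F (e θ • z)
      = ∫⁻ θ in Ioc 0 (2 * Real.pi), ∫⁻ z in ball (0 : ℂ × ℂ) r, F (e θ • z) := by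
    refine lintegral_lintegral_swap (Measurable.aemeasurable ?_)
    exact hFm.comp (Continuous.measurable (by fun_prop))
  have hA : (ENNReal.ofReal (2 * Real.pi) * ‖f c‖ₑ ^ 2) * volume (ball (0 : ℂ × ℂ) r)
      ≤ (∫⁻ z, F z) * ENNReal.ofReal (2 * Real.pi) := by
    calc _ = ∫⁻ z in ball (0 : ℂ × ℂ) r, ENNReal.ofReal (2 * Real.pi) * ‖f c‖ₑ ^ 2 := by
          rw [setLIntegral_const]
      _ ≤ ∫⁻ z in ball (0 : ℂ × ℂ) r, ∫⁻ θ in Ioc 0 (2 * Real.pi), F (e θ • z) :=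
          setLIntegral_mono' measurableSet_ball key
      _ = ∫⁻ θ in Ioc 0 (2 * Real.pi), ∫⁻ z in ball (0 : ℂ × ℂ) r, F (e θ • z) := hswap
      _ ≤ ∫⁻ θ in Ioc 0 (2 * Real.pi), ∫⁻ z, F z := by
          refine lintegral_mono fun θ => ?_
          rw [← hrot θ]
          exact setLIntegral_le_lintegral _ _
      _ = _ := by rw [setLIntegral_const]; simp
  rw [← hFint]
  have hpi : ENNReal.ofReal (2 * Real.pi) ≠ 0 := by simp [Real.pi_pos]
  rw [mul_assoc, mul_comm (∫⁻ z, F z)] at hA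
  exact (ENNReal.mul_le_mul_iff_right hpi ENNReal.ofReal_ne_top).1 hA

/-- Pointwise limits of locally uniformly Cauchy sequences of holomorphic functions are
holomorphic; the hypothesis is required near one point only. -/
theorem bergman_differentiableAt_limit {F : ℕ → ℂ × ℂ → ℂ} {g : ℂ × ℂ → ℂ} {c : ℂ × ℂ} {r : ℝ}
    (hr : 0 < r) (hF : ∀ n, DifferentiableOn ℂ (F n) (ball c r))
    (hc : ∀ ε > 0, ∃ N, ∀ m ≥ N, ∀ n ≥ N, ∀ z ∈ ball c r, ‖F m z - F n z‖ ≤ ε)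
    (hg : ∀ z ∈ ball c r, Tendsto (fun n => F n z) atTop (𝓝 (g z))) :
    DifferentiableAt ℂ g c := by
  have hsub : ∀ z ∈ ball c (r / 2), ball z (r / 2) ⊆ ball c r := fun z hz =>
    ball_subset_ball' (by rw [mem_ball] at hz; linarith)
  have hin : ball c (r / 2) ⊆ ball c r := ball_subset_ball (by linarith)
  have hda : ∀ n, ∀ z ∈ ball c (r / 2), DifferentiableAt ℂ (F n) z := fun n z hz =>
    (hF n).differentiableAt (isOpen_ball.mem_nhds (hin hz))
  have hC : UniformCauchySeqOn (fun n z => fderiv ℂ (F n) z) atTop (ball c (r / 2)) := by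
    rw [Metric.uniformCauchySeqOn_iff]
    intro ε hε
    obtain ⟨N, hN⟩ := hc (ε * r / 16) (by positivity)
    refine ⟨N, fun m hm n hn z hz => ?_⟩
    have hd : DifferentiableOn ℂ (F m - F n) (ball z (r / 2)) :=
      ((hF m).sub (hF n)).mono (hsub z hz)
    have hm' : MapsTo (F m - F n) (ball z (r / 2))
        (closedBall ((F m - F n) z) (ε * r / 8)) := by
      intro w hw
      rw [mem_closedBall, dist_eq_norm]
      have h1 := hN m hm n hn w (hsub z hz hw)
      have h2 := hN m hm n hn z (hin hz)
      calc _ ≤ ‖(F m - F n) w‖ + ‖(F m - F n) z‖ := norm_sub_le _ _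
        _ ≤ ε * r / 16 + ε * r / 16 := add_le_add h1 h2
        _ = _ := by ring
    have h3 := Complex.norm_fderiv_le_div_of_mapsTo_ball hd hm' (by positivity)
    rw [fderiv_sub (hda m z hz) (hda n z hz)] at h3
    rw [dist_eq_norm]
    refine h3.trans_lt ?_
    have : ε * r / 8 / (r / 2) = ε / 4 := by field_simp; norm_num
    rw [this]; linarith
  have hlim : ∀ z ∈ ball c (r / 2), ∃ L, Tendsto (fun n => fderiv ℂ (F n) z) atTop (𝓝 L) :=
    fun z hz => cauchySeq_tendsto_of_complete (hC.cauchySeq hz)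
  choose! g' hg' using hlim
  have hU := hC.tendstoUniformlyOn_of_tendsto hg'
  exact (hasFDerivAt_of_tendstoUniformlyOn isOpen_ball hU
    (fun n z hz => (hda n z hz).hasFDerivAt) (fun z hz => hg z (hin hz))
    (mem_ball_self (by positivity))).differentiableAt

/-- `A²(U)` is a closed subspace of `L²(U)`. -/
theorem isClosed_bergmanSpace {U : Set (ℂ × ℂ)} (hU : IsOpen U) :
    IsClosed (bergmanSpace U : Set (Lp ℂ 2 (volume.restrict U))) := by
  refine IsSeqClosed.isClosed fun u f hu huf => ?_
  choose F hFd hFu using hu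
  have hloc : ∀ c ∈ U, ∃ r > 0, ball c r ⊆ U ∧
      ∀ ε > 0, ∃ N, ∀ m ≥ N, ∀ n ≥ N, ∀ z ∈ ball c r, ‖F m z - F n z‖ ≤ ε := by
    intro c hcU
    obtain ⟨R, hR, hRU⟩ := Metric.isOpen_iff.1 hU c hcU
    have hin : ball c (R / 2) ⊆ ball c R := ball_subset_ball (by linarith)
    refine ⟨R / 2, by positivity, hin.trans hRU, fun ε hε => ?_⟩
    set v := volume (ball (0 : ℂ × ℂ) (R / 2)) with hv
    have hv0 : v ≠ 0 := (measure_ball_pos volume _ (by positivity)).ne'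
    have hvt : v ≠ ∞ := measure_ball_lt_top.ne
    have hbound : ∀ m n, ∀ z ∈ ball c (R / 2),
        ‖F m z - F n z‖ ^ 2 * v.toReal ≤ ‖u m - u n‖ ^ 2 := by
      intro m n z hz
      have hs : ball z (R / 2) ⊆ U := (ball_subset_ball' (by
        rw [mem_ball] at hz; linarith)).trans hRU
      have h1 := bergman_mean_value (((hFd m).sub (hFd n)).mono hs)
      have h2 : ∫⁻ w in ball z (R / 2), ‖(F m - F n) w‖ₑ ^ 2
          ≤ ‖u m - u n‖ₑ ^ 2 := by
        refine (lintegral_mono_set hs).trans (le_of_eq ?_)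
        rw [Lp.enorm_def, eLpNorm_eq_lintegral_rpow_enorm_toReal (by simp) (by simp)]
        rw [← ENNReal.rpow_natCast, ← ENNReal.rpow_mul]
        simp only [ENNReal.toReal_ofNat, Nat.cast_ofNat, one_div, ne_eq, OfNat.ofNat_ne_zero,
          not_false_eq_true, inv_mul_cancel₀, ENNReal.rpow_one]
        refine lintegral_congr_ae ?_
        filter_upwards [Lp.coeFn_sub (u m) (u n), hFu m, hFu n] with w e1 e2 e3
        rw [e1, Pi.sub_apply, Pi.sub_apply, e2, e3, ENNReal.rpow_ofNat]
      have h3 := ENNReal.toReal_mono (by simp) (h1.trans h2)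
      simpa [ENNReal.toReal_mul, ENNReal.toReal_pow, hv] using h3
    have hcs := huf.cauchySeq
    rw [Metric.cauchySeq_iff] at hcs
    have hvp : 0 < v.toReal := ENNReal.toReal_pos hv0 hvt
    obtain ⟨N, hN⟩ := hcs (ε * Real.sqrt v.toReal) (by positivity)
    refine ⟨N, fun m hm n hn z hz => ?_⟩
    have h1 := hbound m n z hz
    have h2 := (hN m hm n hn).le
    rw [dist_eq_norm] at h2
    have h3 : ‖u m - u n‖ ^ 2 ≤ ε ^ 2 * v.toReal := by
      calc _ ≤ (ε * Real.sqrt v.toReal) ^ 2 := by gcongr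
        _ = _ := by rw [mul_pow, Real.sq_sqrt hvp.le]
    have h4 : ‖F m z - F n z‖ ^ 2 ≤ ε ^ 2 := le_of_mul_le_mul_right (h1.trans h3) hvp
    exact le_of_sq_le_sq h4 hε.le
  have hlim : ∀ z ∈ U, ∃ l, Tendsto (fun n => F n z) atTop (𝓝 l) := by
    intro z hz
    obtain ⟨r, hr, -, h⟩ := hloc z hz
    refine cauchySeq_tendsto_of_complete (Metric.cauchySeq_iff.2 fun ε hε => ?_)
    obtain ⟨N, hN⟩ := h (ε / 2) (by positivity)
    refine ⟨N, fun m hm n hn => ?_⟩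
    rw [dist_eq_norm]
    exact (hN m hm n hn z (mem_ball_self hr)).trans_lt (by linarith)
  choose! g hg using hlim
  refine ⟨g, fun c hc => ?_, ?_⟩
  · obtain ⟨r, hr, hrU, h⟩ := hloc c hc
    exact (bergman_differentiableAt_limit hr (fun n => (hFd n).mono hrU) h
      fun z hz => hg z (hrU hz)).differentiableWithinAt
  · obtain ⟨ns, hns, hae⟩ := (tendstoInMeasure_of_tendsto_Lp huf).exists_seq_tendsto_ae
    have hall : ∀ᵐ z ∂volume.restrict U, ∀ n, u n z = F n z := ae_all_iff.2 hFu
    filter_upwards [hae, hall, ae_restrict_mem hU.measurableSet] with z h1 h2 h3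
    simp only [h2] at h1
    exact tendsto_nhds_unique h1 ((hg z h3).comp hns.tendsto_atTop)

theorem isOpen_hartogsTriangle : IsOpen hartogsTriangle :=
  (isOpen_lt continuous_snd.norm continuous_fst.norm).inter
    (isOpen_lt continuous_fst.norm continuous_const)

instance hasOrthogonalProjection_bergmanSpace :
    (bergmanSpace hartogsTriangle).HasOrthogonalProjection :=
  have : CompleteSpace (bergmanSpace hartogsTriangle) :=
    (isClosed_bergmanSpace isOpen_hartogsTriangle).completeSpace_coe
  inferInstance

/-- The Bergman projection of the Hartogs triangle: the orthogonal projection of `L²` onto the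
Bergman space, regarded as an operator from `L²` to itself. -/
noncomputable def hartogsBergmanProjection :
    Lp ℂ 2 (volume.restrict hartogsTriangle) →L[ℂ] Lp ℂ 2 (volume.restrict hartogsTriangle) :=
  (bergmanSpace hartogsTriangle).starProjection

instance isFiniteMeasure_hartogsTriangle :
    IsFiniteMeasure ((volume : Measure (ℂ × ℂ)).restrict hartogsTriangle) := by
  refine isFiniteMeasure_restrict.2 (ne_top_of_le_ne_top (b := volume (ball (0 : ℂ × ℂ) 1))
    measure_ball_lt_top.ne (measure_mono fun z hz => ?_))
  rw [mem_ball_zero_iff, Prod.norm_def]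
  exact max_lt hz.2 (hz.1.trans hz.2)

/-- The inclusion of `L^p` in `L²` for `p ≥ 2`, on the bounded domain `hartogsTriangle`. -/
theorem memLp_two_of_memLp {p : ℝ} (hp : 2 ≤ p) {f : ℂ × ℂ → ℂ}
    (hf : MemLp f (ENNReal.ofReal p) (volume.restrict hartogsTriangle)) :
    MemLp f 2 (volume.restrict hartogsTriangle) :=
  hf.mono_exponent (by simpa using ENNReal.ofReal_le_ofReal hp)

/-! The map `hartogsMap`, (w₁, w₂) ↦ (w₁, w₁w₂), is a biholomorphism from D* × D onto the Hartogs
triangle with real Jacobian |w₁|². Hence f ↦ F = w₁ · f(w₁, w₁w₂) is an isometry of L² that respects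
holomorphy. Square-integrable holomorphic functions extend across a puncture, so the Bergman
projection of the triangle is conjugate to that of the bidisc, a product of two disc kernels
(`hartogsBergmanProjection_ae_eq`). For general p the same substitution gives ∫|F|^p = ∫|f|^p
δ₁^(p-2) (`lintegral_enorm_bidiscLift_rpow`): two of the p powers of |w₁| pay for the Jacobian and
the others form the weight. The target space thus corresponds exactly to the holomorphic functions
in L^p of the bidisc, while L^p of the triangle embeds in L^p of the bidisc because the weight is at
most 1. Boundedness is therefore the L^p boundedness of the bidisc projection, obtained from the
Schur test (`lintegral_lintegral_mul_rpow_le`) and the Forelli–Rudin estimate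
(`lintegral_enorm_discKernel_mul_rpow_le`). For surjectivity, the lift G of g is its own projection,
but its descent G/z₁ = g need not lie in the unweighted L^p. A preimage of G that is small at w₁ = 0
is needed. In one variable, if H is the primitive of h with H(0) = 0, the projection sends |w|²(h +
H/w) to h (`integral_discKernel_mul_sq_mul`). The map h ↦ H/w is bounded on L^p, since its kernel is
dominated by the Bergman kernel. Applied in w₁ to G, this gives F = |w₁|² M with M in L^p and
projection G, and the factor |w₁|² more than absorbs the division by z₁. -/

open ComplexConjugate

/-! ### Elementary properties of the Bergman kernel of the disc. -/

/-- Lebesgue measure of the unit disc. -/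
noncomputable def discMeasure : Measure ℂ := volume.restrict (ball 0 1)

/-- The Bergman kernel of the unit disc. -/
noncomputable def discKernel (w ζ : ℂ) : ℂ := (Real.pi * (1 - w * conj ζ) ^ 2)⁻¹

instance isFiniteMeasure_discMeasure : IsFiniteMeasure discMeasure :=
  isFiniteMeasure_restrict.2 measure_ball_lt_top.ne

theorem ae_discMeasure_norm_lt_one : ∀ᵐ w ∂discMeasure, ‖w‖ < 1 := by
  have h : MeasurableSet (ball (0 : ℂ) 1) := measurableSet_ball
  filter_upwards [ae_restrict_mem (μ := volume) h] with w hw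
  simpa using hw

theorem one_sub_mul_conj_ne_zero {w ζ : ℂ} (hw : ‖w‖ < 1) (hζ : ‖ζ‖ ≤ 1) :
    1 - w * conj ζ ≠ 0 := by
  intro h
  have h1 : ‖w * conj ζ‖ = 1 := by rw [← sub_eq_zero.1 h]; simp
  rw [norm_mul, RCLike.norm_conj] at h1
  nlinarith [norm_nonneg w, norm_nonneg ζ]

theorem one_sub_le_norm_one_sub_mul_conj {w ζ : ℂ} (hζ : ‖ζ‖ ≤ 1) :
    1 - ‖w‖ ≤ ‖1 - w * conj ζ‖ := by
  have h := norm_sub_norm_le (1 : ℂ) (w * conj ζ)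
  rw [norm_mul, RCLike.norm_conj, norm_one] at h
  nlinarith [norm_nonneg w, norm_nonneg ζ]

theorem discKernel_conj (w ζ : ℂ) : conj (discKernel w ζ) = discKernel ζ w := by
  simp [discKernel, mul_comm]

theorem norm_discKernel_le {w ζ : ℂ} (hw : ‖w‖ < 1) (hζ : ‖ζ‖ ≤ 1) :
    ‖discKernel w ζ‖ ≤ (Real.pi * (1 - ‖w‖) ^ 2)⁻¹ := by
  have h1 := one_sub_le_norm_one_sub_mul_conj (w := w) hζ
  have h2 : 0 < 1 - ‖w‖ := by linarith
  rw [discKernel, norm_inv, norm_mul, norm_pow, Complex.norm_real,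
    Real.norm_of_nonneg Real.pi_pos.le]
  gcongr

theorem measurable_discKernel : Measurable (fun p : ℂ × ℂ => discKernel p.1 p.2) := by
  unfold discKernel
  have : Measurable (fun p : ℂ × ℂ => conj p.2) :=
    (Complex.continuous_conj.comp continuous_snd).measurable
  fun_prop

/-! ### Reproducing formulas through polar coordinates and Cauchy's formula. -/

theorem conj_eq_of_norm_eq {w : ℂ} {r : ℝ} (hr : 0 < r) (h : ‖w‖ = r) :
    conj w = r ^ 2 / w := by
  have h0 : w ≠ 0 := by rintro rfl; simp at h; linarith
  rw [eq_div_iff h0, mul_comm, Complex.mul_conj, Complex.normSq_eq_norm_sq, h]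
  push_cast; rfl

/-- On |w| = r the conjugate of w is r²/w, so the kernel becomes w² / (π(w - r²ζ)²), which is
holomorphic in w off r²ζ. Together with the dw/w of the average this is Cauchy's formula for the
derivative of w · m(w) at r²ζ. -/
theorem circleAverage_discKernel_mul {m : ℂ → ℂ} (hm : DifferentiableOn ℂ m (ball 0 1))
    {r : ℝ} (hr : 0 < r) (hr1 : r < 1) {ζ : ℂ} (hζ : ‖ζ‖ < 1) :
    Real.circleAverage (fun w => discKernel ζ w * m w) 0 r
      = (Real.pi : ℂ)⁻¹ * deriv (fun w => w * m w) (r ^ 2 * ζ) := by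
  have hφ : DifferentiableOn ℂ (fun w => w * m w) (ball 0 1) := differentiableOn_id.mul hm
  have hmem : (r ^ 2 * ζ : ℂ) ∈ ball (0 : ℂ) r := by
    simp only [mem_ball_zero_iff, norm_mul, norm_pow, Complex.norm_real, Real.norm_of_nonneg hr.le]
    nlinarith [norm_nonneg ζ, mul_pos hr hr]
  have hcauchy := Complex.two_pi_I_inv_smul_circleIntegral_sub_sq_inv_smul_of_differentiable
    isOpen_ball (closedBall_subset_ball hr1 : closedBall (0:ℂ) r ⊆ ball 0 1) hφ hmem
  rw [← hcauchy, Real.circleAverage_eq_circleIntegral hr.ne', smul_eq_mul, smul_eq_mul,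
    mul_left_comm]
  congr 1
  rw [← circleIntegral.integral_const_mul]
  refine circleIntegral.integral_congr hr.le fun w hw => ?_
  have hw' : ‖w‖ = r := by simpa using hw
  have h0 : w ≠ 0 := by rintro rfl; simp at hw'; linarith
  have hne : w - r ^ 2 * ζ ≠ 0 := by
    intro h
    rw [sub_eq_zero] at h
    rw [mem_ball_zero_iff, ← h, hw'] at hmem
    exact lt_irrefl _ hmem
  have hpi : (Real.pi : ℂ) ≠ 0 := by exact_mod_cast Real.pi_ne_zero
  simp only [discKernel, sub_zero, smul_eq_mul, conj_eq_of_norm_eq hr hw']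
  have : 1 - ζ * (r ^ 2 / w) = (w - r ^ 2 * ζ) / w := by field_simp
  rw [this]
  field_simp

theorem complex_polarCoord_symm_eq_circleMap (p : ℝ × ℝ) :
    Complex.polarCoord.symm p = circleMap 0 p.1 p.2 := by
  rw [Complex.polarCoord_symm_apply, circleMap_zero, Complex.exp_mul_I]
  simp

theorem circleMap_mem_ball_one_iff {p : ℝ × ℝ} (hp : p ∈ Ioi (0 : ℝ) ×ˢ Ioo (-Real.pi) Real.pi) :
    circleMap 0 p.1 p.2 ∈ ball (0 : ℂ) 1 ↔ p ∈ Ioo (0 : ℝ) 1 ×ˢ Ioo (-Real.pi) Real.pi := by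
  obtain ⟨hr, hθ⟩ := hp
  simp only [mem_Ioi] at hr
  simp only [mem_ball_zero_iff, norm_circleMap_zero, abs_of_pos hr, mem_prod, mem_Ioo]
  simp only [mem_Ioo] at hθ
  tauto

theorem Ioo_prod_subset_polarCoord_target :
    Ioo (0 : ℝ) 1 ×ˢ Ioo (-Real.pi) Real.pi ⊆ Ioi (0 : ℝ) ×ˢ Ioo (-Real.pi) Real.pi :=
  prod_mono Ioo_subset_Ioi_self le_rfl

theorem lintegral_discMeasure_polar (u : ℂ → ℝ≥0∞) :
    ∫⁻ w, u w ∂discMeasure = ∫⁻ p in Ioo (0 : ℝ) 1 ×ˢ Ioo (-Real.pi) Real.pi,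
      ENNReal.ofReal p.1 * u (circleMap 0 p.1 p.2) := by
  rw [discMeasure, ← lintegral_indicator measurableSet_ball,
    ← Complex.lintegral_comp_polarCoord_symm, polarCoord_target,
    ← inter_eq_self_of_subset_right Ioo_prod_subset_polarCoord_target,
    inter_comm, ← setLIntegral_indicator (measurableSet_Ioo.prod measurableSet_Ioo)]
  refine setLIntegral_congr_fun (measurableSet_Ioi.prod measurableSet_Ioo) fun p hp => ?_
  simp only [complex_polarCoord_symm_eq_circleMap, indicator, circleMap_mem_ball_one_iff hp,
    smul_eq_mul, mul_ite, mul_zero]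

theorem integral_discMeasure_polar (u : ℂ → ℂ) :
    ∫ w, u w ∂discMeasure = ∫ p in Ioo (0 : ℝ) 1 ×ˢ Ioo (-Real.pi) Real.pi,
      p.1 • u (circleMap 0 p.1 p.2) := by
  rw [discMeasure, ← integral_indicator measurableSet_ball,
    ← Complex.integral_comp_polarCoord_symm, polarCoord_target,
    ← inter_eq_self_of_subset_right Ioo_prod_subset_polarCoord_target,
    ← setIntegral_indicator (measurableSet_Ioo.prod measurableSet_Ioo)]
  refine setIntegral_congr_fun (measurableSet_Ioi.prod measurableSet_Ioo) fun p hp => ?_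
  simp only [complex_polarCoord_symm_eq_circleMap, indicator, circleMap_mem_ball_one_iff hp,
    smul_ite, smul_zero]

theorem continuous_circleMap_uncurry : Continuous fun p : ℝ × ℝ => circleMap 0 p.1 p.2 := by
  simp only [circleMap_zero]
  fun_prop

theorem integral_Ioo_circleMap_eq (u : ℂ → ℂ) (r : ℝ) :
    ∫ θ in Ioo (-Real.pi) Real.pi, u (circleMap 0 r θ)
      = (2 * Real.pi) • Real.circleAverage u 0 r := by
  rw [Real.circleAverage_eq_integral_add (-Real.pi), smul_smul,
    mul_inv_cancel₀ (by positivity), one_smul,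
    intervalIntegral.integral_comp_add_right (fun θ => u (circleMap 0 r θ)),
    intervalIntegral.integral_of_le (by linarith [Real.pi_pos]), integral_Ioc_eq_integral_Ioo]
  congr 3 <;> ring

theorem integral_discMeasure_eq_circleAverage {u : ℂ → ℂ} (hc : ContinuousOn u (ball 0 1))
    (hu : Integrable u discMeasure) :
    ∫ w, u w ∂discMeasure
      = ∫ r in (0 : ℝ)..1, (2 * Real.pi * r : ℂ) * Real.circleAverage u 0 r := by
  have hmS : MeasurableSet (Ioo (0 : ℝ) 1 ×ˢ Ioo (-Real.pi) Real.pi) :=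
    measurableSet_Ioo.prod measurableSet_Ioo
  have hint : IntegrableOn (fun p : ℝ × ℝ => p.1 • u (circleMap 0 p.1 p.2))
      (Ioo (0 : ℝ) 1 ×ˢ Ioo (-Real.pi) Real.pi) := by
    refine ⟨ContinuousOn.aestronglyMeasurable ?_ hmS, ?_⟩
    · refine continuousOn_fst.smul (hc.comp continuous_circleMap_uncurry.continuousOn ?_)
      exact fun p hp => (circleMap_mem_ball_one_iff (Ioo_prod_subset_polarCoord_target hp)).2 hp
    · have h := hu.2
      rw [HasFiniteIntegral, lintegral_discMeasure_polar] at h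
      refine lt_of_eq_of_lt (setLIntegral_congr_fun hmS fun p hp => ?_) h
      simp only [enorm_smul]
      rw [Real.enorm_of_nonneg hp.1.1.le]
  rw [integral_discMeasure_polar, Measure.volume_eq_prod, setIntegral_prod _ hint,
    intervalIntegral.integral_of_le zero_le_one, integral_Ioc_eq_integral_Ioo]
  refine setIntegral_congr_fun measurableSet_Ioo fun r hr => ?_
  simp only
  rw [integral_smul, integral_Ioo_circleMap_eq, smul_smul, Complex.real_smul]
  push_cast
  ring

theorem integrable_discKernel_mul {ζ : ℂ} (hζ : ‖ζ‖ < 1) {h : ℂ → ℂ}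
    (hh : Integrable h discMeasure) : Integrable (fun w => discKernel ζ w * h w) discMeasure := by
  refine hh.bdd_mul (c := (Real.pi * (1 - ‖ζ‖) ^ 2)⁻¹)
    (measurable_discKernel.comp measurable_prodMk_left).aestronglyMeasurable ?_
  filter_upwards [ae_discMeasure_norm_lt_one] with w hw using norm_discKernel_le hζ hw.le

theorem continuousOn_discKernel {ζ : ℂ} (hζ : ‖ζ‖ < 1) :
    ContinuousOn (discKernel ζ) (ball 0 1) := by
  unfold discKernel
  have hc : Continuous fun w : ℂ => conj w := Complex.continuous_conj
  refine ContinuousOn.inv₀ (by fun_prop) fun w hw => ?_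
  have := one_sub_mul_conj_ne_zero hζ (mem_ball_zero_iff.1 hw).le
  have hpi : (Real.pi : ℂ) ≠ 0 := by exact_mod_cast Real.pi_ne_zero
  positivity

theorem sq_mul_mem_ball {r : ℝ} (hr : r ∈ Icc (0 : ℝ) 1) {ζ : ℂ} (hζ : ‖ζ‖ < 1) :
    (r ^ 2 * ζ : ℂ) ∈ ball (0 : ℂ) 1 := by
  simp only [mem_ball_zero_iff, norm_mul, norm_pow, Complex.norm_real, Real.norm_of_nonneg hr.1]
  have : r ^ 2 ≤ 1 := pow_le_one₀ hr.1 hr.2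
  nlinarith [norm_nonneg ζ]

theorem hasDerivAt_pow_mul_comp {h : ℂ → ℂ} (hd : DifferentiableOn ℂ h (ball 0 1)) {ζ : ℂ}
    (hζ : ‖ζ‖ < 1) {r : ℝ} (hr : r ∈ Icc (0 : ℝ) 1) (n : ℕ) :
    HasDerivAt (fun r : ℝ => (r : ℂ) ^ (n + 1) * h (r ^ 2 * ζ))
      ((n + 1) * (r : ℂ) ^ n * h (r ^ 2 * ζ)
        + (r : ℂ) ^ (n + 1) * (deriv h (r ^ 2 * ζ) * (2 * r * ζ))) r := by
  have h1 : HasDerivAt h (deriv h (r ^ 2 * ζ)) ((r : ℂ) ^ 2 * ζ) :=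
    (hd.differentiableAt (isOpen_ball.mem_nhds (sq_mul_mem_ball hr hζ))).hasDerivAt
  have h2 : HasDerivAt (fun s : ℂ => s ^ 2 * ζ) (2 * r * ζ) (r : ℂ) := by
    simpa using (hasDerivAt_pow 2 (r : ℂ)).mul_const ζ
  have h3 := (hasDerivAt_pow (n + 1) (r : ℂ)).mul (HasDerivAt.comp (r : ℂ) h1 h2)
  have h4 := h3.comp_ofReal
  simpa using h4

/-- The integrand is the derivative of r^(n+1) h(r²ζ), which vanishes at r = 0. The case n = 1
serves the reproducing property, and n = 3 its variant with the extra factor |w|². -/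
theorem integral_eq_of_hasDerivAt_pow_mul_comp {h : ℂ → ℂ} (hd : DifferentiableOn ℂ h (ball 0 1))
    {ζ : ℂ} (hζ : ‖ζ‖ < 1) (n : ℕ) :
    ∫ r in (0 : ℝ)..1, ((n + 1) * (r : ℂ) ^ n * h (r ^ 2 * ζ)
        + (r : ℂ) ^ (n + 1) * (deriv h (r ^ 2 * ζ) * (2 * r * ζ))) = h ζ := by
  rw [intervalIntegral.integral_eq_sub_of_hasDerivAt (f := fun r : ℝ =>
    (r : ℂ) ^ (n + 1) * h (r ^ 2 * ζ))]
  · simp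
  · intro r hr
    rw [uIcc_of_le zero_le_one] at hr
    exact hasDerivAt_pow_mul_comp hd hζ hr n
  · refine ContinuousOn.intervalIntegrable ?_
    rw [uIcc_of_le zero_le_one]
    have hmaps : MapsTo (fun r : ℝ => (r ^ 2 * ζ : ℂ)) (Icc 0 1) (ball 0 1) :=
      fun r hr => sq_mul_mem_ball hr hζ
    have hcr : ContinuousOn (fun r : ℝ => (r ^ 2 * ζ : ℂ)) (Icc 0 1) := by fun_prop
    have c1 := hd.continuousOn.comp hcr hmaps
    have c2 := (hd.deriv isOpen_ball).continuousOn.comp hcr hmaps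
    have c3 : ContinuousOn (fun r : ℝ => (r : ℂ)) (Icc 0 1) :=
      Complex.continuous_ofReal.continuousOn
    exact ((continuousOn_const.mul (c3.pow n)).mul c1).add
      ((c3.pow (n + 1)).mul (c2.mul ((continuousOn_const.mul c3).mul continuousOn_const)))

/-- The reproducing property of the Bergman kernel. -/
theorem integral_discKernel_mul {h : ℂ → ℂ} (hd : DifferentiableOn ℂ h (ball 0 1))
    (hi : Integrable h discMeasure) {ζ : ℂ} (hζ : ‖ζ‖ < 1) :
    ∫ w, discKernel ζ w * h w ∂discMeasure = h ζ := by
  rw [integral_discMeasure_eq_circleAverage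
    (ContinuousOn.fun_mul (continuousOn_discKernel hζ) hd.continuousOn)
    (integrable_discKernel_mul hζ hi), ← integral_eq_of_hasDerivAt_pow_mul_comp hd hζ 1]
  -- The endpoint r = 1 has to go, because Cauchy's formula is applied on circles inside the open
  -- disc.
  rw [intervalIntegral.integral_of_le zero_le_one, intervalIntegral.integral_of_le zero_le_one,
    integral_Ioc_eq_integral_Ioo, integral_Ioc_eq_integral_Ioo]
  refine setIntegral_congr_fun measurableSet_Ioo fun r hr => ?_
  have hpi : (Real.pi : ℂ) ≠ 0 := by exact_mod_cast Real.pi_ne_zero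
  have h1 : DifferentiableAt ℂ h (r ^ 2 * ζ) :=
    hd.differentiableAt (isOpen_ball.mem_nhds (sq_mul_mem_ball ⟨hr.1.le, hr.2.le⟩ hζ))
  have h2 := (hasDerivAt_id' ((r : ℂ) ^ 2 * ζ)).fun_mul h1.hasDerivAt
  rw [circleAverage_discKernel_mul hd hr.1 hr.2 hζ, h2.deriv]
  field_simp
  push_cast
  ring

/-- A radial multiple of `m = h + H / w`, with `H` the primitive of `h` that vanishes at `0`, is
mapped to `h` by the Bergman projection. -/
theorem integral_discKernel_mul_sq_mul {h k : ℂ → ℂ} (hd : DifferentiableOn ℂ h (ball 0 1))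
    (kd : DifferentiableOn ℂ k (ball 0 1))
    (hk : ∀ w ∈ ball (0 : ℂ) 1, HasDerivAt (fun w => w * k w) (h w) w)
    (hi : Integrable h discMeasure) (ki : Integrable k discMeasure) {ζ : ℂ} (hζ : ‖ζ‖ < 1) :
    ∫ w, discKernel ζ w * (‖w‖ ^ 2 * (h w + k w)) ∂discMeasure = h ζ := by
  have hmd : DifferentiableOn ℂ (fun w => h w + k w) (ball 0 1) := hd.add kd
  have hmi : Integrable (fun w => (‖w‖ ^ 2 : ℂ) * (h w + k w)) discMeasure := by
    refine (hi.add ki).bdd_mul (c := 1) (by fun_prop) ?_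
    filter_upwards [ae_discMeasure_norm_lt_one] with w hw
    simpa using hw.le
  have hc : ContinuousOn (fun w => (‖w‖ ^ 2 : ℂ) * (h w + k w)) (ball 0 1) := by
    refine ContinuousOn.mul (by fun_prop) hmd.continuousOn
  -- With m = h + k the hypothesis `hk` gives (w m)' = 2h + w h'. The radial integrand is then
  -- 2r³(2h + r²ζ h') at r²ζ, the derivative of r⁴ h(r²ζ); hence the exponent n = 3.
  rw [integral_discMeasure_eq_circleAverage
    (ContinuousOn.fun_mul (continuousOn_discKernel hζ) hc)
    (integrable_discKernel_mul hζ hmi), ← integral_eq_of_hasDerivAt_pow_mul_comp hd hζ 3]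
  rw [intervalIntegral.integral_of_le zero_le_one, intervalIntegral.integral_of_le zero_le_one,
    integral_Ioc_eq_integral_Ioo, integral_Ioc_eq_integral_Ioo]
  refine setIntegral_congr_fun measurableSet_Ioo fun r hr => ?_
  have hpi : (Real.pi : ℂ) ≠ 0 := by exact_mod_cast Real.pi_ne_zero
  have hmem := sq_mul_mem_ball ⟨hr.1.le, hr.2.le⟩ hζ
  have h1 : DifferentiableAt ℂ h (r ^ 2 * ζ) :=
    hd.differentiableAt (isOpen_ball.mem_nhds hmem)
  have h2 := ((hasDerivAt_id' ((r : ℂ) ^ 2 * ζ)).mul h1.hasDerivAt).add (hk _ hmem)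
  have h3 : HasDerivAt (fun w => w * (h w + k w))
      (1 * h (r ^ 2 * ζ) + r ^ 2 * ζ * deriv h (r ^ 2 * ζ) + h (r ^ 2 * ζ)) ((r : ℂ) ^ 2 * ζ) := by
    refine h2.congr_of_eventuallyEq (Eventually.of_forall fun w => ?_)
    simp [mul_add]
  have h4 : Real.circleAverage (fun w => discKernel ζ w * (‖w‖ ^ 2 * (h w + k w))) 0 r
      = r ^ 2 * Real.circleAverage (fun w => discKernel ζ w * (h w + k w)) 0 r := by
    rw [← smul_eq_mul, ← Real.circleAverage_fun_smul]
    refine Real.circleAverage_congr_sphere fun w hw => ?_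
    have : ‖w‖ = r := by simpa [abs_of_pos hr.1] using hw
    simp only [this, smul_eq_mul]
    ring
  rw [h4, circleAverage_discKernel_mul hmd hr.1 hr.2 hζ, h3.deriv]
  field_simp
  push_cast
  ring

/-! ### Removable singularities of square-integrable holomorphic functions. -/

/-- Mean value inequality for `|h|²` over a disc. -/
theorem enorm_sq_mul_volume_ball_le {h : ℂ → ℂ} {c : ℂ} {r : ℝ} (hr : 0 < r)
    (hd : DifferentiableOn ℂ h (ball c r)) :
    ‖h c‖ₑ ^ 2 * volume (ball (0 : ℂ) r) ≤ ∫⁻ z in ball c r, ‖h z‖ₑ ^ 2 := by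
  -- In the sup norm a ball of ℂ² is a product of discs, so the inequality on ℂ² for a function of
  -- z₁ alone yields that on ℂ after cancelling the area of the second disc.
  have hb : ball (c, (0 : ℂ)) r = ball c r ×ˢ ball 0 r := (ball_prod_same _ _ _).symm
  have hb0 : ball (0 : ℂ × ℂ) r = ball 0 r ×ˢ ball 0 r := (ball_prod_same (0 : ℂ) (0 : ℂ) _).symm
  have hd2 : DifferentiableOn ℂ (fun z : ℂ × ℂ => h z.1) (ball (c, (0 : ℂ)) r) := by
    rw [hb]
    exact hd.comp differentiableOn_fst fun z hz => hz.1
  have h1 := bergman_mean_value hd2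
  have hm : AEMeasurable (fun z => ‖h z‖ₑ ^ 2) (volume.restrict (ball c r)) :=
    ((hd.continuousOn.aestronglyMeasurable measurableSet_ball).enorm).pow_const 2
  have h2 := lintegral_prod_mul (ν := volume.restrict (ball (0 : ℂ) r)) hm
    (g := fun _ => 1) aemeasurable_const
  rw [hb, hb0, Measure.volume_eq_prod, Measure.prod_prod, ← Measure.prod_restrict] at h1
  simp only [mul_one, lintegral_const, Measure.restrict_apply, MeasurableSet.univ, univ_inter,
    one_mul] at h2
  rw [h2, ← mul_assoc] at h1
  exact (ENNReal.mul_le_mul_iff_left (measure_ball_pos volume _ hr).ne'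
    measure_ball_lt_top.ne).1 h1

/-- Square-integrable holomorphic functions extend across a puncture. -/
theorem exists_differentiableOn_of_lintegral_sq_lt_top {h : ℂ → ℂ}
    (hd : DifferentiableOn ℂ h (ball 0 1 \ {0}))
    (hi : ∫⁻ z, ‖h z‖ₑ ^ 2 ∂discMeasure < ∞) :
    ∃ k : ℂ → ℂ, DifferentiableOn ℂ k (ball 0 1) ∧ ∀ w, w ≠ 0 → k w = h w := by
  refine ⟨Function.update h 0 (limUnder (𝓝[≠] 0) h),
    Complex.differentiableOn_update_limUnder_of_isLittleO (ball_mem_nhds 0 one_pos) hd ?_,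
    fun w hw => Function.update_of_ne hw _ _⟩
  -- The value h(0) has no meaning here, but it enters the criterion h(z) - h(0) = o(1/z); as a
  -- constant it is harmless.
  have hconst : (fun _ : ℂ => h 0) =o[𝓝[≠] 0] fun z : ℂ => (z - 0)⁻¹ := by
    refine (Asymptotics.isLittleO_const_left).2 (Or.inr ?_)
    simpa [Function.comp_def] using tendsto_norm_inv_nhdsNE_zero_atTop (α := ℂ)
  refine Asymptotics.IsLittleO.sub (Asymptotics.isLittleO_iff.2 fun c hc => ?_) hconst
  have hlim : Tendsto (fun w : ℂ => ∫⁻ z in ball (0 : ℂ) (2 * ‖w‖), ‖h z‖ₑ ^ 2 ∂discMeasure) (𝓝[≠] 0)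
      (𝓝 0) := by
    refine tendsto_setLIntegral_zero hi.ne ?_
    have hv : Tendsto (fun w : ℂ => ENNReal.ofReal (2 * ‖w‖) ^ 2 * NNReal.pi) (𝓝[≠] 0) (𝓝 0) := by
      have : Continuous fun w : ℂ => ENNReal.ofReal (2 * ‖w‖) ^ 2 * NNReal.pi := by
        refine ENNReal.continuous_mul_const ENNReal.coe_ne_top |>.comp ?_
        exact (ENNReal.continuous_pow 2).comp (ENNReal.continuous_ofReal.comp (by fun_prop))
      simpa using (this.tendsto 0).mono_left nhdsWithin_le_nhds
    refine tendsto_of_tendsto_of_tendsto_of_le_of_le tendsto_const_nhds hv (fun _ => bot_le)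
      fun w => ?_
    rw [← Complex.volume_ball]
    exact Measure.restrict_apply_le _ _
  have hpos : 0 < ENNReal.ofReal (c ^ 2) * NNReal.pi := by
    refine ENNReal.mul_pos (by simpa using hc.ne') (by simp [NNReal.pi_ne_zero])
  have hsmall : ∀ᶠ w : ℂ in 𝓝[≠] 0, w ∈ ball (0 : ℂ) (1 / 2) :=
    nhdsWithin_le_nhds (ball_mem_nhds 0 (by norm_num))
  filter_upwards [hlim.eventually (gt_mem_nhds hpos), hsmall, self_mem_nhdsWithin] with w hw hw2 hw0
  have hw0' : 0 < ‖w‖ := norm_pos_iff.2 hw0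
  rw [mem_ball_zero_iff] at hw2
  -- The disc of radius |w| about w misses the origin and lies in the disc of radius 2|w| about 0.
  -- The mean value inequality then bounds π|w|²|h(w)|² by the mass of |h|² on that disc, which
  -- tends to 0; this gives h(w) = o(1/w).
  have hsub : ball w ‖w‖ ⊆ ball 0 1 \ {0} := by
    intro z hz
    refine ⟨?_, ?_⟩
    · rw [mem_ball_zero_iff]
      rw [mem_ball_iff_norm] at hz
      have := norm_sub_norm_le z w
      linarith
    · rintro rfl
      simp at hz
  have h1 := enorm_sq_mul_volume_ball_le hw0' (hd.mono hsub)
  have h2 : ∫⁻ z in ball w ‖w‖, ‖h z‖ₑ ^ 2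
      ≤ ∫⁻ z in ball (0 : ℂ) (2 * ‖w‖), ‖h z‖ₑ ^ 2 ∂discMeasure := by
    rw [discMeasure, Measure.restrict_restrict measurableSet_ball]
    refine lintegral_mono_set fun z hz => ⟨?_, (hsub hz).1⟩
    rw [mem_ball_zero_iff]
    rw [mem_ball_iff_norm] at hz
    have := norm_sub_norm_le z w
    linarith
  have h3 := (h1.trans h2).trans hw.le
  rw [Complex.volume_ball, ← mul_assoc, ENNReal.mul_le_mul_iff_left (by simp [NNReal.pi_ne_zero])
    ENNReal.coe_ne_top, ← mul_pow, ← ofReal_norm, ← ENNReal.ofReal_mul (norm_nonneg _),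
    ← ENNReal.ofReal_pow (by positivity), ENNReal.ofReal_le_ofReal_iff (by positivity)] at h3
  have h4 := (pow_le_pow_iff_left₀ (by positivity) hc.le two_ne_zero).1 h3
  rw [sub_zero, norm_inv, ← div_eq_mul_inv, le_div_iff₀ hw0']
  exact h4

/-! ### The primitive divided by w, as an integral operator. -/

/-- The average `∫₀¹ h(tw) dt` of a holomorphic function along radii, as an integral operator. -/
noncomputable def radialAverage (h : ℂ → ℂ) (w : ℂ) : ℂ :=
  ∫ ζ, (Real.pi * (1 - w * conj ζ))⁻¹ * h ζ ∂discMeasure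

theorem hasDerivAt_radialAverage {h : ℂ → ℂ} (hi : Integrable h discMeasure) {w : ℂ}
    (hw : ‖w‖ < 1) :
    Integrable (fun ζ => conj ζ * discKernel w ζ * h ζ) discMeasure ∧
    HasDerivAt (radialAverage h) (∫ ζ, conj ζ * discKernel w ζ * h ζ ∂discMeasure) w := by
  set δ := (1 - ‖w‖) / 2 with hδ
  have hδ0 : 0 < δ := by rw [hδ]; linarith
  have hball : ∀ x ∈ ball w δ, ‖x‖ < 1 ∧ δ ≤ 1 - ‖x‖ := by
    intro x hx
    rw [mem_ball_iff_norm] at hx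
    have := norm_sub_norm_le x w
    constructor <;> linarith
  have hconj : Measurable fun ζ : ℂ => conj ζ := Complex.continuous_conj.measurable
  have hmeas : ∀ x : ℂ, Measurable fun ζ => (Real.pi * (1 - x * conj ζ))⁻¹ := by
    intro x; fun_prop
  have hpi : (Real.pi : ℂ) ≠ 0 := by exact_mod_cast Real.pi_ne_zero
  refine hasDerivAt_integral_of_dominated_loc_of_deriv_le
    (F' := fun x ζ => conj ζ * discKernel x ζ * h ζ)
    (bound := fun ζ => (Real.pi * δ ^ 2)⁻¹ * ‖h ζ‖) (ball_mem_nhds w hδ0) ?_ ?_ ?_ ?_ ?_ ?_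
  · exact Eventually.of_forall fun x => (hmeas x).aestronglyMeasurable.mul hi.1
  · refine hi.bdd_mul (c := (Real.pi * (1 - ‖w‖))⁻¹) (hmeas w).aestronglyMeasurable ?_
    filter_upwards [ae_discMeasure_norm_lt_one] with ζ hζ
    rw [norm_inv, norm_mul, Complex.norm_real, Real.norm_of_nonneg Real.pi_pos.le]
    have h1 := one_sub_le_norm_one_sub_mul_conj (w := w) hζ.le
    have h2 : 0 < 1 - ‖w‖ := by linarith
    gcongr
  · exact (hconj.mul (measurable_discKernel.comp measurable_prodMk_left)).aestronglyMeasurable.mul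
      hi.1
  · filter_upwards [ae_discMeasure_norm_lt_one] with ζ hζ x hx
    obtain ⟨hx1, hx2⟩ := hball x hx
    rw [norm_mul, norm_mul, RCLike.norm_conj]
    have h1 := norm_discKernel_le hx1 hζ.le
    have h2 : (Real.pi * (1 - ‖x‖) ^ 2)⁻¹ ≤ (Real.pi * δ ^ 2)⁻¹ := by gcongr
    gcongr
    calc ‖ζ‖ * ‖discKernel x ζ‖ ≤ 1 * ‖discKernel x ζ‖ := by gcongr
      _ ≤ _ := by rw [one_mul]; exact h1.trans h2
  · exact hi.norm.const_mul _
  · filter_upwards [ae_discMeasure_norm_lt_one] with ζ hζ x hx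
    obtain ⟨hx1, hx2⟩ := hball x hx
    have hne := one_sub_mul_conj_ne_zero hx1 hζ.le
    have h1 : HasDerivAt (fun x : ℂ => Real.pi * (1 - x * conj ζ)) (Real.pi * (-(1 * conj ζ))) x :=
      (((hasDerivAt_id' x).mul_const (conj ζ)).const_sub 1).const_mul _
    have h2 := (h1.inv (mul_ne_zero hpi hne)).mul_const (h ζ)
    convert! h2 using 1
    rw [discKernel]
    field_simp

theorem differentiableOn_radialAverage {h : ℂ → ℂ} (hi : Integrable h discMeasure) :
    DifferentiableOn ℂ (radialAverage h) (ball 0 1) := fun _ hw =>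
  (hasDerivAt_radialAverage hi (mem_ball_zero_iff.1 hw)).2.differentiableAt.differentiableWithinAt

/-- With t = w · conj ζ one has (1 - t)⁻¹ + t(1 - t)⁻² = (1 - t)⁻², so differentiating w times the
operator produces the Bergman kernel, which reproduces h. Writing the primitive as an integral
operator makes its L^p bound a matter of comparing kernels. -/
theorem hasDerivAt_mul_radialAverage {h : ℂ → ℂ} (hd : DifferentiableOn ℂ h (ball 0 1))
    (hi : Integrable h discMeasure) {w : ℂ} (hw : ‖w‖ < 1) :
    HasDerivAt (fun w => w * radialAverage h w) (h w) w := by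
  obtain ⟨h1, h2⟩ := hasDerivAt_radialAverage hi hw
  have h3 := (hasDerivAt_id' w).mul h2
  convert! h3 using 1
  rw [← integral_discKernel_mul hd hi hw, ← integral_const_mul, radialAverage, ← sub_eq_iff_eq_add,
    one_mul, ← integral_sub (integrable_discKernel_mul hw hi) (h1.const_mul w)]
  refine integral_congr_ae ?_
  filter_upwards [ae_discMeasure_norm_lt_one] with ζ hζ
  have hne := one_sub_mul_conj_ne_zero hw hζ.le
  have hpi : (Real.pi : ℂ) ≠ 0 := by exact_mod_cast Real.pi_ne_zero
  simp only [discKernel]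
  field_simp

/-! ### The Schur test and the L^p boundedness of the disc kernel. -/

/-- The Schur test. -/
theorem lintegral_lintegral_mul_rpow_le {α : Type*} [MeasurableSpace α] {μ : Measure α}
    [SFinite μ] {k : α → α → ℝ≥0∞} (hk : Measurable (Function.uncurry k)) {p q : ℝ}
    (hpq : p.HolderConjugate q) {s : α → ℝ≥0∞} (hs : Measurable s)
    (hs0 : ∀ᵐ x ∂μ, s x ≠ 0 ∧ s x ≠ ∞) {C : ℝ≥0∞}
    (h₁ : ∀ᵐ x ∂μ, ∫⁻ y, k x y * s y ^ q ∂μ ≤ C * s x ^ q)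
    (h₂ : ∀ᵐ y ∂μ, ∫⁻ x, k x y * s x ^ p ∂μ ≤ C * s y ^ p)
    {u : α → ℝ≥0∞} (hu : AEMeasurable u μ) :
    ∫⁻ x, (∫⁻ y, k x y * u y ∂μ) ^ p ∂μ ≤ C ^ (p / q) * C * ∫⁻ x, u x ^ p ∂μ := by
  have hp := hpq.pos
  have hq := hpq.symm.pos
  have hkx : ∀ x, Measurable (k x) := fun x => hk.comp measurable_prodMk_left
  have step1 : ∀ᵐ x ∂μ, (∫⁻ y, k x y * u y ∂μ) ^ p
      ≤ C ^ (p / q) * ∫⁻ y, s x ^ p * k x y * ((s y)⁻¹ * u y) ^ p ∂μ := by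
    filter_upwards [h₁] with x hx
    -- Hölder is applied to the splitting k u = (k^(1/q) s)(k^(1/p) s⁻¹ u). The first factor is
    -- controlled by `h₁`; the second is left for `h₂` after exchanging the integrals.
    have e1 : ∫⁻ y, k x y * u y ∂μ
        = ∫⁻ y, ((fun y => k x y ^ (1 / q) * s y) *
          fun y => k x y ^ (1 / p) * ((s y)⁻¹ * u y)) y ∂μ := by
      refine lintegral_congr_ae ?_
      filter_upwards [hs0] with y hy
      simp only [Pi.mul_apply]
      have : k x y ^ (1 / q) * k x y ^ (1 / p) = k x y := by
        rw [← ENNReal.rpow_add_of_nonneg _ _ (by positivity) (by positivity), one_div, one_div,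
          add_comm, hpq.inv_add_inv_eq_one, ENNReal.rpow_one]
      calc k x y * u y = (k x y ^ (1 / q) * k x y ^ (1 / p)) * (s y * (s y)⁻¹) * u y := by
            rw [this, ENNReal.mul_inv_cancel hy.1 hy.2, mul_one]
        _ = _ := by ring
    have e2 := ENNReal.lintegral_mul_le_Lp_mul_Lq μ hpq.symm
      (f := fun y => k x y ^ (1 / q) * s y) (g := fun y => k x y ^ (1 / p) * ((s y)⁻¹ * u y))
      (((hkx x).pow_const _).mul hs).aemeasurable
      (((hkx x).pow_const _).aemeasurable.mul (hs.inv.aemeasurable.mul hu))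
    have e3 : ∫⁻ y, (k x y ^ (1 / q) * s y) ^ q ∂μ = ∫⁻ y, k x y * s y ^ q ∂μ := by
      refine lintegral_congr fun y => ?_
      rw [ENNReal.mul_rpow_of_nonneg _ _ hq.le, ← ENNReal.rpow_mul, one_div_mul_cancel hq.ne',
        ENNReal.rpow_one]
    have e4 : ∫⁻ y, (k x y ^ (1 / p) * ((s y)⁻¹ * u y)) ^ p ∂μ
        = ∫⁻ y, k x y * ((s y)⁻¹ * u y) ^ p ∂μ := by
      refine lintegral_congr fun y => ?_
      rw [ENNReal.mul_rpow_of_nonneg _ _ hp.le, ← ENNReal.rpow_mul, one_div_mul_cancel hp.ne',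
        ENNReal.rpow_one]
    rw [e3, e4] at e2
    rw [e1]
    calc _ ≤ ((C * s x ^ q) ^ (1 / q) * (∫⁻ y, k x y * ((s y)⁻¹ * u y) ^ p ∂μ) ^ (1 / p)) ^ p := by
          refine ENNReal.rpow_le_rpow (e2.trans ?_) hp.le
          gcongr
      _ = C ^ (p / q) * (s x ^ p * ∫⁻ y, k x y * ((s y)⁻¹ * u y) ^ p ∂μ) := by
          rw [ENNReal.mul_rpow_of_nonneg _ _ hp.le, ← ENNReal.rpow_mul, ← ENNReal.rpow_mul,
            one_div_mul_cancel hp.ne', ENNReal.rpow_one,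
            ENNReal.mul_rpow_of_nonneg _ _ (by positivity), ← ENNReal.rpow_mul]
          have : q * (1 / q * p) = p := by field_simp
          rw [this, mul_assoc, one_div_mul_eq_div]
      _ = _ := by
          have hmy : AEMeasurable (fun y => k x y * ((s y)⁻¹ * u y) ^ p) μ :=
            (hkx x).aemeasurable.mul ((hs.inv.aemeasurable.mul hu).pow_const p)
          rw [← lintegral_const_mul'' _ hmy]
          simp only [mul_assoc]
  have hm : AEMeasurable (Function.uncurry fun x y => s x ^ p * k x y * ((s y)⁻¹ * u y) ^ p)
      (μ.prod μ) :=
    ((hs.comp measurable_fst).pow_const p |>.mul hk).aemeasurable.mul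
      (((hs.comp measurable_snd).inv.aemeasurable.mul hu.comp_snd).pow_const p)
  calc _ ≤ ∫⁻ x, C ^ (p / q) * ∫⁻ y, s x ^ p * k x y * ((s y)⁻¹ * u y) ^ p ∂μ ∂μ :=
        lintegral_mono_ae step1
    _ = C ^ (p / q) * ∫⁻ x, ∫⁻ y, s x ^ p * k x y * ((s y)⁻¹ * u y) ^ p ∂μ ∂μ :=
        lintegral_const_mul'' _ hm.lintegral_prod_right'
    _ = C ^ (p / q) * ∫⁻ y, ∫⁻ x, s x ^ p * k x y * ((s y)⁻¹ * u y) ^ p ∂μ ∂μ := by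
        rw [lintegral_lintegral_swap hm]
    _ ≤ C ^ (p / q) * ∫⁻ y, C * u y ^ p ∂μ := by
        refine mul_le_mul_right (lintegral_mono_ae ?_) _
        filter_upwards [h₂, hs0] with y hy hy0
        have hmy : Measurable fun x => s x ^ p * k x y :=
          (hs.pow_const p).mul (hk.comp measurable_prodMk_right)
        rw [lintegral_mul_const _ hmy]
        calc _ ≤ C * s y ^ p * ((s y)⁻¹ * u y) ^ p := by
              gcongr
              simpa only [mul_comm] using hy
          _ = C * u y ^ p := by
              rw [mul_assoc, ← ENNReal.mul_rpow_of_nonneg _ _ hp.le, ← mul_assoc (s y),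
                ENNReal.mul_inv_cancel hy0.1 hy0.2, one_mul]
    _ = _ := by rw [lintegral_const_mul'' _ (hu.pow_const p), mul_assoc]

/-- On |ζ| = r the modulus of the kernel is r² / (π|ζ - r²w|²), a constant multiple of the Poisson
kernel of that circle at r²w, whose average is 1. -/
theorem circleAverage_norm_discKernel {w : ℂ} (hw : ‖w‖ < 1) {r : ℝ} (hr : 0 < r) (hr1 : r < 1) :
    Real.circleAverage (fun ζ => ‖discKernel w ζ‖) 0 r
      = Real.pi⁻¹ * (1 - r ^ 2 * ‖w‖ ^ 2)⁻¹ := by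
  have hmem : (r ^ 2 * w : ℂ) ∈ ball (0 : ℂ) r := by
    simp only [mem_ball_zero_iff, norm_mul, norm_pow, Complex.norm_real, Real.norm_of_nonneg hr.le]
    nlinarith [norm_nonneg w, mul_pos hr hr]
  have hP := DiffContOnCl.circleAverage_poissonKernel_smul' (f := fun _ => (1 : ℂ)) (c := 0)
    (R := r) diffContOnCl_const hmem
  have hden : 0 < 1 - r ^ 2 * ‖w‖ ^ 2 := by
    have h1 : r ^ 2 < 1 := pow_lt_one₀ hr.le hr1 two_ne_zero
    have h2 : ‖w‖ ^ 2 < 1 := pow_lt_one₀ (norm_nonneg _) hw two_ne_zero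
    nlinarith [sq_nonneg r, sq_nonneg ‖w‖]
  have hpt : ∀ ζ ∈ sphere (0 : ℂ) |r|, ‖discKernel w ζ‖
      = Real.pi⁻¹ * (1 - r ^ 2 * ‖w‖ ^ 2)⁻¹ *
        ((‖ζ - 0‖ ^ 2 - ‖(r ^ 2 * w : ℂ) - 0‖ ^ 2) / ‖(ζ - 0) - (r ^ 2 * w - 0)‖ ^ 2) := by
    intro ζ hζ
    have hζr : ‖ζ‖ = r := by simpa [abs_of_pos hr] using hζ
    have h0 : ζ ≠ 0 := by rintro rfl; simp at hζr; linarith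
    have hne : ζ - r ^ 2 * w ≠ 0 := by
      intro h
      rw [sub_eq_zero] at h
      rw [mem_ball_zero_iff, ← h, hζr] at hmem
      exact lt_irrefl _ hmem
    have h1 : 1 - w * conj ζ = (ζ - r ^ 2 * w) / ζ := by
      rw [conj_eq_of_norm_eq hr hζr]
      field_simp
    have hn : ‖ζ - r ^ 2 * w‖ ≠ 0 := norm_ne_zero_iff.2 hne
    rw [discKernel, h1]
    simp only [sub_zero, norm_inv, norm_mul, norm_pow, norm_div, Complex.norm_real, hζr,
      Real.norm_of_nonneg Real.pi_pos.le, Real.norm_of_nonneg hr.le]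
    have hden' := hden.ne'
    have : r ^ 2 - (r ^ 2 * ‖w‖) ^ 2 = r ^ 2 * (1 - r ^ 2 * ‖w‖ ^ 2) := by ring
    rw [this]
    field_simp
  rw [Real.circleAverage_congr_sphere hpt]
  simp only [← smul_eq_mul (Real.pi⁻¹ * (1 - r ^ 2 * ‖w‖ ^ 2)⁻¹)]
  rw [Real.circleAverage_fun_smul]
  have hre : Real.circleAverage (fun z : ℂ => (‖z - 0‖ ^ 2 - ‖(r ^ 2 * w : ℂ) - 0‖ ^ 2) /
      ‖(z - 0) - (r ^ 2 * w - 0)‖ ^ 2) 0 r = 1 := by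
    have : ∀ x : ℝ, x • (1 : ℂ) = (x : ℂ) := by simp
    simp only [this] at hP
    rw [Real.circleAverage, intervalIntegral.integral_ofReal, Complex.real_smul,
      ← Complex.ofReal_mul] at hP
    exact_mod_cast hP
  rw [hre, smul_eq_mul, mul_one]

theorem lintegral_Ioo_enorm_discKernel {w : ℂ} (hw : ‖w‖ < 1) {r : ℝ} (hr : 0 < r) (hr1 : r < 1) :
    ∫⁻ θ in Ioo (-Real.pi) Real.pi, ‖discKernel w (circleMap 0 r θ)‖ₑ
      = ENNReal.ofReal (2 * (1 - r ^ 2 * ‖w‖ ^ 2)⁻¹) := by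
  have hcont : Continuous fun θ : ℝ => discKernel w (circleMap 0 r θ) := by
    refine (continuousOn_discKernel hw).comp_continuous (continuous_circleMap 0 r) fun θ => ?_
    simpa [abs_of_pos hr] using hr1
  have h1 : ∫ θ in Ioo (-Real.pi) Real.pi, ‖discKernel w (circleMap 0 r θ)‖
      = 2 * (1 - r ^ 2 * ‖w‖ ^ 2)⁻¹ := by
    have := circleAverage_norm_discKernel hw hr hr1
    rw [Real.circleAverage_eq_integral_add (-Real.pi),
      intervalIntegral.integral_comp_add_right (fun θ => ‖discKernel w (circleMap 0 r θ)‖),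
      intervalIntegral.integral_of_le (by linarith [Real.pi_pos]), integral_Ioc_eq_integral_Ioo,
      zero_add, smul_eq_mul, inv_mul_eq_iff_eq_mul₀ (by positivity)] at this
    have e : 2 * Real.pi + -Real.pi = Real.pi := by ring
    rw [e] at this
    rw [this]
    field_simp
  rw [← h1, ofReal_integral_eq_lintegral_ofReal]
  · simp only [ofReal_norm]
  · exact (hcont.norm.continuousOn.integrableOn_Icc (a := -Real.pi) (b := Real.pi)).mono_set
      Ioo_subset_Icc_self
  · exact Eventually.of_forall fun _ => norm_nonneg _

/-- The integral is split at u = y: below, u^(-a)/y is integrable because a < 1; above, u^(-a-1) is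
integrable because a > 0. Both parts scale as y^(-a). -/
theorem lintegral_Ioi_rpow_mul_min_le {a : ℝ} (ha : 0 < a) (ha1 : a < 1) {y : ℝ} (hy : 0 < y) :
    ∫⁻ u in Ioi 0, ENNReal.ofReal (u ^ (-a) * min y⁻¹ u⁻¹)
      ≤ ENNReal.ofReal (((1 - a)⁻¹ + a⁻¹) * y ^ (-a)) := by
  have h1 : ∫⁻ u in Ioc 0 y, ENNReal.ofReal (u ^ (-a) * min y⁻¹ u⁻¹)
      ≤ ENNReal.ofReal ((1 - a)⁻¹ * y ^ (-a)) := by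
    have hint : IntervalIntegrable (fun u : ℝ => u ^ (-a) * y⁻¹) volume 0 y :=
      (intervalIntegral.intervalIntegrable_rpow' (by linarith)).mul_const _
    calc _ ≤ ∫⁻ u in Ioc 0 y, ENNReal.ofReal (u ^ (-a) * y⁻¹) := by
          refine setLIntegral_mono' measurableSet_Ioc fun u hu => ENNReal.ofReal_le_ofReal ?_
          have : 0 ≤ u ^ (-a) := Real.rpow_nonneg hu.1.le _
          gcongr
          exact min_le_left _ _
      _ = ENNReal.ofReal (∫ u in Ioc 0 y, u ^ (-a) * y⁻¹) := by
          rw [ofReal_integral_eq_lintegral_ofReal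
            ((intervalIntegrable_iff_integrableOn_Ioc_of_le hy.le).1 hint)]
          filter_upwards [ae_restrict_mem measurableSet_Ioc] with u hu
          exact mul_nonneg (Real.rpow_nonneg hu.1.le _) (by positivity)
      _ ≤ _ := by
          refine ENNReal.ofReal_le_ofReal (le_of_eq ?_)
          rw [← intervalIntegral.integral_of_le hy.le, intervalIntegral.integral_mul_const,
            integral_rpow (Or.inl (by linarith)), Real.zero_rpow (by linarith),
            Real.rpow_add hy, Real.rpow_one]
          have : -a + 1 = 1 - a := by ring
          rw [this]
          have : 1 - a ≠ 0 := by linarith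
          field_simp
          ring
  have h2 : ∫⁻ u in Ioi y, ENNReal.ofReal (u ^ (-a) * min y⁻¹ u⁻¹)
      ≤ ENNReal.ofReal (a⁻¹ * y ^ (-a)) := by
    calc _ ≤ ∫⁻ u in Ioi y, ENNReal.ofReal (u ^ (-a - 1)) := by
          refine setLIntegral_mono' measurableSet_Ioi fun u hu => ENNReal.ofReal_le_ofReal ?_
          have hu0 : 0 < u := hy.trans hu
          rw [Real.rpow_sub hu0, Real.rpow_one, div_eq_mul_inv]
          have : 0 ≤ u ^ (-a) := Real.rpow_nonneg hu0.le _
          gcongr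
          exact min_le_right _ _
      _ = ENNReal.ofReal (∫ u in Ioi y, u ^ (-a - 1)) := by
          rw [ofReal_integral_eq_lintegral_ofReal
            (integrableOn_Ioi_rpow_of_lt (by linarith) hy)]
          filter_upwards [ae_restrict_mem measurableSet_Ioi] with u hu
          exact Real.rpow_nonneg (hy.trans hu).le _
      _ ≤ _ := by
          refine ENNReal.ofReal_le_ofReal (le_of_eq ?_)
          rw [integral_Ioi_rpow_of_lt (by linarith) hy]
          have : -a - 1 + 1 = -a := by ring
          rw [this]
          field_simp
  have h3 : Ioi (0 : ℝ) = Ioc 0 y ∪ Ioi y := (Ioc_union_Ioi_eq_Ioi hy.le).symm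
  rw [h3]
  refine (lintegral_union_le _ _ _).trans ((add_le_add h1 h2).trans (le_of_eq ?_))
  have : 0 < 1 - a := by linarith
  rw [← ENNReal.ofReal_add (by positivity) (by positivity), add_mul]

/-- The quantity 1 - r²x² is at least both 1 - x² and 1 - r. This brings the angular integral of the
kernel to the form of `lintegral_Ioi_rpow_mul_min_le`, with u = 1 - r and y = 1 - x². -/
theorem one_sub_rpow_mul_inv_le_of_mem_Ioo {a : ℝ} (ha : 0 < a) {x r : ℝ} (hx : 0 ≤ x) (hx1 : x < 1)
    (hr : r ∈ Ioo (0 : ℝ) 1) :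
    r * ((1 - r ^ 2) ^ (-a) * (2 * (1 - r ^ 2 * x ^ 2)⁻¹))
      ≤ 2 * ((1 - r) ^ (-a) * min (1 - x ^ 2)⁻¹ (1 - r)⁻¹) := by
  obtain ⟨h0, h1⟩ := hr
  have hx2 : x ^ 2 < 1 := pow_lt_one₀ hx hx1 two_ne_zero
  have hr2 : r ^ 2 ≤ r := by nlinarith
  have e1 : (1 - r ^ 2) ^ (-a) ≤ (1 - r) ^ (-a) :=
    Real.rpow_le_rpow_of_nonpos (by linarith) (by linarith) (by linarith)
  have e2 : (1 - r ^ 2 * x ^ 2)⁻¹ ≤ min (1 - x ^ 2)⁻¹ (1 - r)⁻¹ := by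
    refine le_min ?_ ?_
    · exact inv_anti₀ (by linarith) (by nlinarith [sq_nonneg x])
    · exact inv_anti₀ (by linarith) (by nlinarith [sq_nonneg x, sq_nonneg r])
  have e3 : 0 ≤ (1 - r ^ 2) ^ (-a) := Real.rpow_nonneg (by linarith) _
  have e4 : 0 ≤ (1 - r ^ 2 * x ^ 2)⁻¹ := inv_nonneg.2 (by nlinarith [sq_nonneg x, sq_nonneg r])
  calc _ ≤ 1 * ((1 - r ^ 2) ^ (-a) * (2 * (1 - r ^ 2 * x ^ 2)⁻¹)) := by
        gcongr
    _ = 2 * ((1 - r ^ 2) ^ (-a) * (1 - r ^ 2 * x ^ 2)⁻¹) := by ring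
    _ ≤ _ := by gcongr

/-- The Forelli–Rudin estimate for the Bergman kernel of the disc. -/
theorem lintegral_enorm_discKernel_mul_rpow_le {a : ℝ} (ha : 0 < a) (ha1 : a < 1) {w : ℂ}
    (hw : ‖w‖ < 1) :
    ∫⁻ ζ, ‖discKernel w ζ‖ₑ * ENNReal.ofReal (1 - ‖ζ‖ ^ 2) ^ (-a) ∂discMeasure
      ≤ ENNReal.ofReal (2 * ((1 - a)⁻¹ + a⁻¹)) * ENNReal.ofReal (1 - ‖w‖ ^ 2) ^ (-a) := by
  have hw2 : 0 < 1 - ‖w‖ ^ 2 := by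
    linarith [pow_lt_one₀ (norm_nonneg w) hw two_ne_zero]
  have hm : Measurable fun p : ℝ × ℝ => ‖discKernel w (circleMap 0 p.1 p.2)‖ₑ :=
    (measurable_discKernel.comp (measurable_const.prodMk
      continuous_circleMap_uncurry.measurable)).enorm
  rw [lintegral_discMeasure_polar, Measure.volume_eq_prod, setLIntegral_prod]
  swap
  · simp only [norm_circleMap_zero]
    exact (Measurable.mul (by fun_prop) (hm.mul (by fun_prop))).aemeasurable
  have h1 : ∀ r ∈ Ioo (0 : ℝ) 1, ∫⁻ θ in Ioo (-Real.pi) Real.pi, ENNReal.ofReal r *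
      (‖discKernel w (circleMap 0 r θ)‖ₑ * ENNReal.ofReal (1 - ‖circleMap 0 r θ‖ ^ 2) ^ (-a))
      ≤ ENNReal.ofReal 2 *
        ENNReal.ofReal ((1 - r) ^ (-a) * min (1 - ‖w‖ ^ 2)⁻¹ (1 - r)⁻¹) := by
    intro r hr
    have hr2 : 0 < 1 - r ^ 2 := by linarith [pow_lt_one₀ hr.1.le hr.2 two_ne_zero]
    simp only [norm_circleMap_zero, sq_abs]
    rw [lintegral_const_mul' _ _ ENNReal.ofReal_ne_top,
      lintegral_mul_const' _ _ (by simp [ENNReal.ofReal_rpow_of_pos hr2]),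
      lintegral_Ioo_enorm_discKernel hw hr.1 hr.2, ENNReal.ofReal_rpow_of_pos hr2,
      mul_comm (ENNReal.ofReal (2 * _)), ← ENNReal.ofReal_mul (Real.rpow_nonneg hr2.le _),
      ← ENNReal.ofReal_mul hr.1.le, ← ENNReal.ofReal_mul zero_le_two]
    exact ENNReal.ofReal_le_ofReal (one_sub_rpow_mul_inv_le_of_mem_Ioo ha (norm_nonneg w) hw hr)
  set G : ℝ → ℝ≥0∞ := fun u => ENNReal.ofReal (u ^ (-a) * min (1 - ‖w‖ ^ 2)⁻¹ u⁻¹) with hG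
  calc _ ≤ ∫⁻ r in Ioo (0 : ℝ) 1, ENNReal.ofReal 2 * G (1 - r) :=
        setLIntegral_mono' measurableSet_Ioo h1
    _ = ENNReal.ofReal 2 * ∫⁻ r in Ioo (0 : ℝ) 1, G (1 - r) :=
        lintegral_const_mul' _ _ ENNReal.ofReal_ne_top
    -- The range 0 < u < 1 of u = 1 - r is enlarged to the half-line, where the bound is explicit.
    _ ≤ ENNReal.ofReal 2 * ∫⁻ r, (Ioi 0).indicator G (1 - r) := by
        refine mul_le_mul_right ?_ _
        rw [← lintegral_indicator measurableSet_Ioo]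
        refine lintegral_mono fun r => ?_
        by_cases hr : r ∈ Ioo (0 : ℝ) 1
        · rw [indicator_of_mem hr, indicator_of_mem (by simpa using hr.2)]
        · rw [indicator_of_notMem hr]
          exact bot_le
    _ = ENNReal.ofReal 2 * ∫⁻ u in Ioi 0, G u := by
        rw [lintegral_sub_left_eq_self (fun r => (Ioi 0).indicator G r),
          lintegral_indicator measurableSet_Ioi]
    _ ≤ ENNReal.ofReal 2 * ENNReal.ofReal (((1 - a)⁻¹ + a⁻¹) * (1 - ‖w‖ ^ 2) ^ (-a)) := by
        gcongr
        exact lintegral_Ioi_rpow_mul_min_le ha ha1 hw2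
    _ = _ := by
        have : 0 < 1 - a := by linarith
        rw [ENNReal.ofReal_rpow_of_pos hw2, ← ENNReal.ofReal_mul zero_le_two,
          ← ENNReal.ofReal_mul (by positivity), mul_assoc]

/-- The weight used in the Schur test for the Bergman kernel. -/
noncomputable def schurWeight (c : ℝ) (ζ : ℂ) : ℝ≥0∞ := ENNReal.ofReal (1 - ‖ζ‖ ^ 2) ^ (-c)

theorem measurable_schurWeight (c : ℝ) : Measurable (schurWeight c) := by
  unfold schurWeight
  fun_prop

theorem schurWeight_ne_zero_ne_top (c : ℝ) {ζ : ℂ} (hζ : ‖ζ‖ < 1) :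
    schurWeight c ζ ≠ 0 ∧ schurWeight c ζ ≠ ∞ := by
  have : 0 < 1 - ‖ζ‖ ^ 2 := by linarith [pow_lt_one₀ (norm_nonneg ζ) hζ two_ne_zero]
  rw [schurWeight, ENNReal.ofReal_rpow_of_pos this]
  exact ⟨(ENNReal.ofReal_pos.2 (Real.rpow_pos_of_pos this _)).ne', ENNReal.ofReal_ne_top⟩

/-- The exponent 1/(pq) turns the q-th power of the weight into (1 - |ζ|²)^(-1/p) and the p-th power
into (1 - |ζ|²)^(-1/q). Both exponents lie in the range 0 < a < 1 of the Forelli–Rudin estimate, so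
one weight serves both halves of the Schur test. The constant is symmetric in p and q since 1 - 1/p
= 1/q. -/
theorem lintegral_enorm_discKernel_mul_schurWeight_le {p q : ℝ} (hpq : p.HolderConjugate q) {w : ℂ}
    (hw : ‖w‖ < 1) :
    ∫⁻ ζ, ‖discKernel w ζ‖ₑ * schurWeight (1 / (p * q)) ζ ^ q ∂discMeasure
      ≤ ENNReal.ofReal (2 * (q + p)) * schurWeight (1 / (p * q)) w ^ q := by
  have hp := hpq.pos
  have hq := hpq.symm.pos
  have h1 : 1 - p⁻¹ = q⁻¹ := hpq.one_sub_inv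
  have e : -(1 / (p * q)) * q = -p⁻¹ := by field_simp
  have h := lintegral_enorm_discKernel_mul_rpow_le (inv_pos.2 hp) (inv_lt_one_of_one_lt₀ hpq.lt) hw
  rw [h1, inv_inv, inv_inv] at h
  simpa only [schurWeight, ← ENNReal.rpow_mul, e] using h

theorem enorm_discKernel_comm (w ζ : ℂ) : ‖discKernel w ζ‖ₑ = ‖discKernel ζ w‖ₑ := by
  rw [← discKernel_conj, RCLike.enorm_conj]

/-- The Bergman kernel of the disc defines a bounded positive operator on `L^p`. -/
theorem lintegral_lintegral_enorm_discKernel_rpow_le {p q : ℝ} (hpq : p.HolderConjugate q)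
    {u : ℂ → ℝ≥0∞} (hu : AEMeasurable u discMeasure) :
    ∫⁻ w, (∫⁻ ζ, ‖discKernel w ζ‖ₑ * u ζ ∂discMeasure) ^ p ∂discMeasure
      ≤ ENNReal.ofReal (2 * (q + p)) ^ (p / q) * ENNReal.ofReal (2 * (q + p))
        * ∫⁻ ζ, u ζ ^ p ∂discMeasure := by
  refine lintegral_lintegral_mul_rpow_le (k := fun w ζ => ‖discKernel w ζ‖ₑ)
    measurable_discKernel.enorm hpq (measurable_schurWeight (1 / (p * q))) ?_ ?_ ?_ hu
  · filter_upwards [ae_discMeasure_norm_lt_one] with w hw using schurWeight_ne_zero_ne_top _ hw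
  · filter_upwards [ae_discMeasure_norm_lt_one] with w hw using
      lintegral_enorm_discKernel_mul_schurWeight_le hpq hw
  · filter_upwards [ae_discMeasure_norm_lt_one] with w hw
    have := lintegral_enorm_discKernel_mul_schurWeight_le hpq.symm hw
    simp only [enorm_discKernel_comm _ w]
    rwa [add_comm, mul_comm q p] at this

/-! ### The Bergman kernel of the bidisc and its L^p bounds. -/

/-- Lebesgue measure of the bidisc. -/
noncomputable def bidiscMeasure : Measure (ℂ × ℂ) := discMeasure.prod discMeasure

instance isFiniteMeasure_bidiscMeasure : IsFiniteMeasure bidiscMeasure :=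
  inferInstanceAs (IsFiniteMeasure (discMeasure.prod discMeasure))

/-- The Bergman kernel of the bidisc. -/
noncomputable def bidiscKernel (w ζ : ℂ × ℂ) : ℂ := discKernel w.1 ζ.1 * discKernel w.2 ζ.2

/-- The integral operator defined by the Bergman kernel of the bidisc. -/
noncomputable def bidiscProjection (F : ℂ × ℂ → ℂ) (w : ℂ × ℂ) : ℂ :=
  ∫ ζ, bidiscKernel w ζ * F ζ ∂bidiscMeasure

theorem ae_bidiscMeasure_norm_lt_one : ∀ᵐ w ∂bidiscMeasure, ‖w.1‖ < 1 ∧ ‖w.2‖ < 1 :=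
  (Measure.quasiMeasurePreserving_fst.ae ae_discMeasure_norm_lt_one).and
    (Measure.quasiMeasurePreserving_snd.ae ae_discMeasure_norm_lt_one)

theorem measurable_bidiscKernel : Measurable fun p : (ℂ × ℂ) × (ℂ × ℂ) => bidiscKernel p.1 p.2 := by
  have h1 : Measurable fun p : (ℂ × ℂ) × (ℂ × ℂ) => (p.1.1, p.2.1) :=
    (measurable_fst.comp measurable_fst).prodMk (measurable_fst.comp measurable_snd)
  have h2 : Measurable fun p : (ℂ × ℂ) × (ℂ × ℂ) => (p.1.2, p.2.2) :=
    (measurable_snd.comp measurable_fst).prodMk (measurable_snd.comp measurable_snd)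
  have h3 := (measurable_discKernel.comp h1).mul (measurable_discKernel.comp h2)
  exact h3

theorem bidiscKernel_conj (w ζ : ℂ × ℂ) : conj (bidiscKernel w ζ) = bidiscKernel ζ w := by
  simp [bidiscKernel, discKernel_conj]

theorem enorm_bidiscKernel_comm (w ζ : ℂ × ℂ) : ‖bidiscKernel w ζ‖ₑ = ‖bidiscKernel ζ w‖ₑ := by
  rw [← bidiscKernel_conj, RCLike.enorm_conj]

theorem lintegral_enorm_bidiscKernel_mul_schurWeight_le {p q : ℝ} (hpq : p.HolderConjugate q)
    {w : ℂ × ℂ} (hw₁ : ‖w.1‖ < 1) (hw₂ : ‖w.2‖ < 1) :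
    ∫⁻ ζ, ‖bidiscKernel w ζ‖ₑ *
        (schurWeight (1 / (p * q)) ζ.1 * schurWeight (1 / (p * q)) ζ.2) ^ q ∂bidiscMeasure
      ≤ ENNReal.ofReal (2 * (q + p)) ^ 2 *
        (schurWeight (1 / (p * q)) w.1 * schurWeight (1 / (p * q)) w.2) ^ q := by
  have hm : ∀ x : ℂ, AEMeasurable
      (fun ζ => ‖discKernel x ζ‖ₑ * schurWeight (1 / (p * q)) ζ ^ q) discMeasure := fun x =>
    ((measurable_discKernel.comp measurable_prodMk_left).enorm.mul
      ((measurable_schurWeight _).pow_const _)).aemeasurable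
  have h := lintegral_prod_mul (hm w.1) (hm w.2)
  have hq := hpq.symm.nonneg
  calc _ = ∫⁻ ζ : ℂ × ℂ, (‖discKernel w.1 ζ.1‖ₑ * schurWeight (1 / (p * q)) ζ.1 ^ q) *
        (‖discKernel w.2 ζ.2‖ₑ * schurWeight (1 / (p * q)) ζ.2 ^ q) ∂bidiscMeasure := by
        refine lintegral_congr fun ζ => ?_
        rw [bidiscKernel, enorm_mul, ENNReal.mul_rpow_of_nonneg _ _ hq]
        ring
    _ ≤ _ := by
        rw [bidiscMeasure, h, ENNReal.mul_rpow_of_nonneg _ _ hq]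
        refine (mul_le_mul' (lintegral_enorm_discKernel_mul_schurWeight_le hpq hw₁)
          (lintegral_enorm_discKernel_mul_schurWeight_le hpq hw₂)).trans (le_of_eq ?_)
        ring

/-- The Bergman kernel of the bidisc defines a bounded positive operator on `L^p`. -/
theorem lintegral_lintegral_enorm_bidiscKernel_rpow_le {p q : ℝ} (hpq : p.HolderConjugate q)
    {u : ℂ × ℂ → ℝ≥0∞} (hu : AEMeasurable u bidiscMeasure) :
    ∫⁻ w, (∫⁻ ζ, ‖bidiscKernel w ζ‖ₑ * u ζ ∂bidiscMeasure) ^ p ∂bidiscMeasure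
      ≤ (ENNReal.ofReal (2 * (q + p)) ^ 2) ^ (p / q) * ENNReal.ofReal (2 * (q + p)) ^ 2
        * ∫⁻ ζ, u ζ ^ p ∂bidiscMeasure := by
  refine lintegral_lintegral_mul_rpow_le (k := fun w ζ => ‖bidiscKernel w ζ‖ₑ)
    measurable_bidiscKernel.enorm hpq (s := fun ζ => schurWeight (1 / (p * q)) ζ.1 *
      schurWeight (1 / (p * q)) ζ.2) (((measurable_schurWeight _).comp measurable_fst).mul
        ((measurable_schurWeight _).comp measurable_snd)) ?_ ?_ ?_ hu
  · filter_upwards [ae_bidiscMeasure_norm_lt_one] with w hw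
    have h1 := schurWeight_ne_zero_ne_top (1 / (p * q)) hw.1
    have h2 := schurWeight_ne_zero_ne_top (1 / (p * q)) hw.2
    exact ⟨mul_ne_zero h1.1 h2.1, ENNReal.mul_ne_top h1.2 h2.2⟩
  · filter_upwards [ae_bidiscMeasure_norm_lt_one] with w hw using
      lintegral_enorm_bidiscKernel_mul_schurWeight_le hpq hw.1 hw.2
  · filter_upwards [ae_bidiscMeasure_norm_lt_one] with w hw
    have := lintegral_enorm_bidiscKernel_mul_schurWeight_le hpq.symm hw.1 hw.2
    simp only [enorm_bidiscKernel_comm _ w]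
    rwa [add_comm, mul_comm q p] at this

theorem exists_lintegral_enorm_bidiscProjection_rpow_le {p : ℝ} (hp : 2 ≤ p) :
    ∃ C : ℝ≥0, ∀ F : ℂ × ℂ → ℂ, AEStronglyMeasurable F bidiscMeasure →
      ∫⁻ w, ‖bidiscProjection F w‖ₑ ^ p ∂bidiscMeasure ≤ C * ∫⁻ w, ‖F w‖ₑ ^ p ∂bidiscMeasure := by
  have hpq := Real.HolderConjugate.conjExponent (show 1 < p by linarith)
  refine ⟨((ENNReal.ofReal (2 * (p.conjExponent + p)) ^ 2) ^ (p / p.conjExponent) *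
    ENNReal.ofReal (2 * (p.conjExponent + p)) ^ 2).toNNReal, fun F hF => ?_⟩
  rw [ENNReal.coe_toNNReal]
  · refine le_trans (lintegral_mono fun w => ?_)
      (lintegral_lintegral_enorm_bidiscKernel_rpow_le hpq hF.enorm)
    refine ENNReal.rpow_le_rpow ?_ (by linarith)
    refine (enorm_integral_le_lintegral_enorm _).trans (le_of_eq ?_)
    simp only [enorm_mul]
  · refine ENNReal.mul_ne_top (ENNReal.rpow_ne_top_of_nonneg ?_ ?_) ?_
    · exact div_nonneg (by linarith) hpq.symm.nonneg
    · exact ENNReal.pow_ne_top ENNReal.ofReal_ne_top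
    · exact ENNReal.pow_ne_top ENNReal.ofReal_ne_top

/-- Since |1 - w · conj ζ| ≤ 2, the kernel with exponent 1 is at most twice the Bergman kernel in
modulus, and the Schur bound of the latter carries over. -/
theorem enorm_radialAverage_le (h : ℂ → ℂ) {w : ℂ} (hw : ‖w‖ < 1) :
    ‖radialAverage h w‖ₑ ≤ 2 * ∫⁻ ζ, ‖discKernel w ζ‖ₑ * ‖h ζ‖ₑ ∂discMeasure := by
  rw [← lintegral_const_mul' _ _ (by simp)]
  refine (enorm_integral_le_lintegral_enorm _).trans (lintegral_mono_ae ?_)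
  filter_upwards [ae_discMeasure_norm_lt_one] with ζ hζ
  rw [enorm_mul, ← mul_assoc]
  gcongr
  have hne := norm_pos_iff.2 (one_sub_mul_conj_ne_zero hw hζ.le)
  have h2 : ‖1 - w * conj ζ‖ ≤ 2 := by
    refine (norm_sub_le _ _).trans ?_
    rw [norm_mul, RCLike.norm_conj, norm_one]
    nlinarith [norm_nonneg w, norm_nonneg ζ]
  have h3 : ‖(Real.pi * (1 - w * conj ζ))⁻¹‖ ≤ 2 * ‖discKernel w ζ‖ := by
    rw [discKernel, norm_inv, norm_inv, norm_mul, norm_mul, norm_pow, Complex.norm_real,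
      Real.norm_of_nonneg Real.pi_pos.le, ← div_eq_mul_inv, inv_eq_one_div,
      div_le_div_iff₀ (by positivity) (by positivity)]
    nlinarith [mul_nonneg (mul_nonneg Real.pi_pos.le hne.le) (sub_nonneg.2 h2)]
  rw [← ofReal_norm, ← ofReal_norm, ← ENNReal.ofReal_ofNat, ← ENNReal.ofReal_mul zero_le_two]
  exact ENNReal.ofReal_le_ofReal h3

theorem exists_lintegral_enorm_radialAverage_rpow_le {p : ℝ} (hp : 2 ≤ p) :
    ∃ C : ℝ≥0, ∀ h : ℂ → ℂ, AEStronglyMeasurable h discMeasure →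
      ∫⁻ w, ‖radialAverage h w‖ₑ ^ p ∂discMeasure ≤ C * ∫⁻ w, ‖h w‖ₑ ^ p ∂discMeasure := by
  have hpq := Real.HolderConjugate.conjExponent (show 1 < p by linarith)
  refine ⟨(2 ^ p * (ENNReal.ofReal (2 * (p.conjExponent + p)) ^ (p / p.conjExponent) *
    ENNReal.ofReal (2 * (p.conjExponent + p)))).toNNReal, fun h hh => ?_⟩
  have h2 : (2 : ℝ≥0∞) ^ p ≠ ∞ := ENNReal.rpow_ne_top_of_nonneg (by linarith) (by simp)
  rw [ENNReal.coe_toNNReal]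
  · rw [mul_assoc (2 ^ p)]
    refine le_trans ?_ (mul_le_mul_right
      (lintegral_lintegral_enorm_discKernel_rpow_le hpq hh.enorm) _)
    rw [← lintegral_const_mul' _ _ h2]
    refine lintegral_mono_ae ?_
    filter_upwards [ae_discMeasure_norm_lt_one] with w hw
    rw [← ENNReal.mul_rpow_of_nonneg _ _ (by linarith)]
    exact ENNReal.rpow_le_rpow (enorm_radialAverage_le h hw) (by linarith)
  · refine ENNReal.mul_ne_top h2 (ENNReal.mul_ne_top (ENNReal.rpow_ne_top_of_nonneg ?_ ?_) ?_)
    · exact div_nonneg (by linarith) hpq.symm.nonneg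
    · exact ENNReal.ofReal_ne_top
    · exact ENNReal.ofReal_ne_top

theorem norm_bidiscKernel_le {w ζ : ℂ × ℂ} (hw₁ : ‖w.1‖ < 1) (hw₂ : ‖w.2‖ < 1) (hζ₁ : ‖ζ.1‖ ≤ 1)
    (hζ₂ : ‖ζ.2‖ ≤ 1) :
    ‖bidiscKernel w ζ‖ ≤ (Real.pi * (1 - ‖w.1‖) ^ 2)⁻¹ * (Real.pi * (1 - ‖w.2‖) ^ 2)⁻¹ := by
  rw [bidiscKernel, norm_mul]
  have h1 := norm_discKernel_le hw₁ hζ₁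
  have h2 := norm_discKernel_le hw₂ hζ₂
  gcongr

theorem integrable_bidiscKernel_mul {w : ℂ × ℂ} (hw₁ : ‖w.1‖ < 1) (hw₂ : ‖w.2‖ < 1)
    {F : ℂ × ℂ → ℂ} (hF : Integrable F bidiscMeasure) :
    Integrable (fun ζ => bidiscKernel w ζ * F ζ) bidiscMeasure := by
  refine hF.bdd_mul (c := (Real.pi * (1 - ‖w.1‖) ^ 2)⁻¹ * (Real.pi * (1 - ‖w.2‖) ^ 2)⁻¹)
    (measurable_bidiscKernel.comp measurable_prodMk_left).aestronglyMeasurable ?_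
  filter_upwards [ae_bidiscMeasure_norm_lt_one] with ζ hζ
  exact norm_bidiscKernel_le hw₁ hw₂ hζ.1.le hζ.2.le

/-! ### Holomorphy of Bergman integrals on the bidisc. -/

/-- The derivative of the Bergman kernel of the disc in its holomorphic variable. -/
noncomputable def discKernelDeriv (w ζ : ℂ) : ℂ :=
  2 * conj ζ * (Real.pi * (1 - w * conj ζ) ^ 3)⁻¹

theorem hasDerivAt_discKernel {w ζ : ℂ} (hw : ‖w‖ < 1) (hζ : ‖ζ‖ ≤ 1) :
    HasDerivAt (fun w => discKernel w ζ) (discKernelDeriv w ζ) w := by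
  have hpi : (Real.pi : ℂ) ≠ 0 := by exact_mod_cast Real.pi_ne_zero
  have hne := one_sub_mul_conj_ne_zero hw hζ
  have h1 : HasDerivAt (fun x : ℂ => Real.pi * (1 - x * conj ζ) ^ 2)
      (Real.pi * (((2 : ℕ) : ℂ) * (1 - w * conj ζ) ^ (2 - 1) * (-(1 * conj ζ)))) w :=
    ((((hasDerivAt_id' w).mul_const (conj ζ)).const_sub 1).fun_pow 2).const_mul _
  have h2 := h1.fun_inv (mul_ne_zero hpi (pow_ne_zero 2 hne))
  convert! h2 using 1
  rw [discKernelDeriv]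
  generalize 1 - w * conj ζ = z at hne
  field_simp
  norm_num [mul_comm]

theorem norm_discKernelDeriv_le {w ζ : ℂ} (hw : ‖w‖ < 1) (hζ : ‖ζ‖ ≤ 1) :
    ‖discKernelDeriv w ζ‖ ≤ 2 * (Real.pi * (1 - ‖w‖) ^ 3)⁻¹ := by
  have h1 := one_sub_le_norm_one_sub_mul_conj (w := w) hζ
  have h2 : 0 < 1 - ‖w‖ := by linarith
  rw [discKernelDeriv, norm_mul, norm_mul, norm_inv, norm_mul, norm_pow, Complex.norm_real,
    Real.norm_of_nonneg Real.pi_pos.le, RCLike.norm_conj, Complex.norm_ofNat]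
  calc 2 * ‖ζ‖ * (Real.pi * ‖1 - w * conj ζ‖ ^ 3)⁻¹
      ≤ 2 * 1 * (Real.pi * (1 - ‖w‖) ^ 3)⁻¹ := by gcongr
    _ = _ := by ring

theorem measurable_discKernel_right (w : ℂ) : Measurable (discKernel w) := by
  unfold discKernel
  have hconj : Measurable fun ζ : ℂ => conj ζ := Complex.continuous_conj.measurable
  fun_prop

theorem measurable_discKernelDeriv (w : ℂ) : Measurable (discKernelDeriv w) := by
  unfold discKernelDeriv
  have hconj : Measurable fun ζ : ℂ => conj ζ := Complex.continuous_conj.measurable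
  fun_prop

/-- The derivative of the Bergman kernel of the bidisc in its holomorphic variable. -/
noncomputable def bidiscKernelFDeriv (w ζ : ℂ × ℂ) : ℂ × ℂ →L[ℂ] ℂ :=
  (discKernel w.1 ζ.1 * discKernelDeriv w.2 ζ.2) • ContinuousLinearMap.snd ℂ ℂ ℂ
    + (discKernel w.2 ζ.2 * discKernelDeriv w.1 ζ.1) • ContinuousLinearMap.fst ℂ ℂ ℂ

theorem hasFDerivAt_bidiscKernel {w ζ : ℂ × ℂ} (hw₁ : ‖w.1‖ < 1) (hw₂ : ‖w.2‖ < 1)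
    (hζ₁ : ‖ζ.1‖ ≤ 1) (hζ₂ : ‖ζ.2‖ ≤ 1) :
    HasFDerivAt (fun w => bidiscKernel w ζ) (bidiscKernelFDeriv w ζ) w := by
  have h1 : HasFDerivAt (fun y : ℂ × ℂ => discKernel y.1 ζ.1)
      (discKernelDeriv w.1 ζ.1 • ContinuousLinearMap.fst ℂ ℂ ℂ) w :=
    HasDerivAt.comp_hasFDerivAt (h₂ := fun x => discKernel x ζ.1) w
      (hasDerivAt_discKernel hw₁ hζ₁) hasFDerivAt_fst
  have h2 : HasFDerivAt (fun y : ℂ × ℂ => discKernel y.2 ζ.2)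
      (discKernelDeriv w.2 ζ.2 • ContinuousLinearMap.snd ℂ ℂ ℂ) w :=
    HasDerivAt.comp_hasFDerivAt (h₂ := fun x => discKernel x ζ.2) w
      (hasDerivAt_discKernel hw₂ hζ₂) hasFDerivAt_snd
  have h3 := h1.fun_mul h2
  rw [smul_smul, smul_smul] at h3
  exact h3

theorem aestronglyMeasurable_bidiscKernelFDeriv (w : ℂ × ℂ) :
    AEStronglyMeasurable (bidiscKernelFDeriv w) bidiscMeasure := by
  have a1 : Measurable fun ζ : ℂ × ℂ => discKernel w.1 ζ.1 :=
    (measurable_discKernel_right w.1).comp measurable_fst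
  have a2 : Measurable fun ζ : ℂ × ℂ => discKernelDeriv w.2 ζ.2 :=
    (measurable_discKernelDeriv w.2).comp measurable_snd
  have b1 : Measurable fun ζ : ℂ × ℂ => discKernel w.2 ζ.2 :=
    (measurable_discKernel_right w.2).comp measurable_snd
  have b2 : Measurable fun ζ : ℂ × ℂ => discKernelDeriv w.1 ζ.1 :=
    (measurable_discKernelDeriv w.1).comp measurable_fst
  have m1 := ((a1.mul a2).aestronglyMeasurable (μ := bidiscMeasure)).smul_const
    (ContinuousLinearMap.snd ℂ ℂ ℂ)
  have m2 := ((b1.mul b2).aestronglyMeasurable (μ := bidiscMeasure)).smul_const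
    (ContinuousLinearMap.fst ℂ ℂ ℂ)
  exact m1.add m2

theorem norm_bidiscKernelFDeriv_le {w ζ : ℂ × ℂ} {δ : ℝ} (hδ : 0 < δ) (hw₁ : δ ≤ 1 - ‖w.1‖)
    (hw₂ : δ ≤ 1 - ‖w.2‖) (hζ₁ : ‖ζ.1‖ ≤ 1) (hζ₂ : ‖ζ.2‖ ≤ 1) :
    ‖bidiscKernelFDeriv w ζ‖ ≤ 2 * ((Real.pi * δ ^ 2)⁻¹ * (2 * (Real.pi * δ ^ 3)⁻¹)) := by
  set A : ℝ := (Real.pi * δ ^ 2)⁻¹ with hA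
  set B : ℝ := 2 * (Real.pi * δ ^ 3)⁻¹ with hB
  have hA0 : 0 ≤ A := by positivity
  have hB0 : 0 ≤ B := by positivity
  have hKb : ∀ {x ζ : ℂ}, δ ≤ 1 - ‖x‖ → ‖ζ‖ ≤ 1 → ‖discKernel x ζ‖ ≤ A := by
    intro x ζ hx hζ
    refine (norm_discKernel_le (by linarith) hζ).trans ?_
    rw [hA]
    gcongr
  have hDb : ∀ {x ζ : ℂ}, δ ≤ 1 - ‖x‖ → ‖ζ‖ ≤ 1 → ‖discKernelDeriv x ζ‖ ≤ B := by
    intro x ζ hx hζ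
    refine (norm_discKernelDeriv_le (by linarith) hζ).trans ?_
    rw [hB]
    gcongr
  have n1 := ContinuousLinearMap.norm_fst_le ℂ ℂ ℂ
  have n2 := ContinuousLinearMap.norm_snd_le ℂ ℂ ℂ
  have key : ∀ {a b : ℂ} {L : ℂ × ℂ →L[ℂ] ℂ}, ‖a‖ ≤ A → ‖b‖ ≤ B → ‖L‖ ≤ 1 →
      ‖(a * b) • L‖ ≤ A * B := by
    intro a b L ha hb hL
    rw [norm_smul, norm_mul]
    calc ‖a‖ * ‖b‖ * ‖L‖ ≤ A * B * 1 := by gcongr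
      _ = A * B := mul_one _
  rw [two_mul]
  exact norm_add_le_of_le (key (hKb hw₁ hζ₁) (hDb hw₂ hζ₂) n2)
    (key (hKb hw₂ hζ₂) (hDb hw₁ hζ₁) n1)

/-- The Bergman integral of an integrable function is holomorphic on the bidisc. -/
theorem differentiableAt_bidiscProjection {F : ℂ × ℂ → ℂ} (hF : Integrable F bidiscMeasure)
    {w : ℂ × ℂ} (hw₁ : ‖w.1‖ < 1) (hw₂ : ‖w.2‖ < 1) :
    DifferentiableAt ℂ (bidiscProjection F) w := by
  set δ := min ((1 - ‖w.1‖) / 2) ((1 - ‖w.2‖) / 2)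
  have hδ0 : 0 < δ := lt_min (by linarith) (by linarith)
  have hball : ∀ x ∈ ball w δ, δ ≤ 1 - ‖x.1‖ ∧ δ ≤ 1 - ‖x.2‖ := by
    intro x hx
    rw [mem_ball_iff_norm, Prod.norm_def, max_lt_iff] at hx
    have e1 := norm_sub_norm_le x.1 w.1
    have e2 := norm_sub_norm_le x.2 w.2
    have e3 : δ ≤ (1 - ‖w.1‖) / 2 := min_le_left _ _
    have e4 : δ ≤ (1 - ‖w.2‖) / 2 := min_le_right _ _
    have e5 := hx.1
    have e6 := hx.2
    simp only [Prod.fst_sub, Prod.snd_sub] at e5 e6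
    constructor <;> linarith
  have hmB : ∀ x : ℂ × ℂ, AEStronglyMeasurable (bidiscKernel x) bidiscMeasure := fun x =>
    (measurable_bidiscKernel.comp measurable_prodMk_left).aestronglyMeasurable
  refine (hasFDerivAt_integral_of_dominated_of_fderiv_le
    (F' := fun x ζ => F ζ • bidiscKernelFDeriv x ζ)
    (bound := fun ζ => ‖F ζ‖ * (2 * ((Real.pi * δ ^ 2)⁻¹ * (2 * (Real.pi * δ ^ 3)⁻¹))))
    (ball_mem_nhds w hδ0) ?_ (integrable_bidiscKernel_mul hw₁ hw₂ hF)
    (hF.1.smul (aestronglyMeasurable_bidiscKernelFDeriv w)) ?_ (hF.norm.mul_const _)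
    ?_).differentiableAt
  · exact Eventually.of_forall fun x => (hmB x).mul hF.1
  · filter_upwards [ae_bidiscMeasure_norm_lt_one] with ζ hζ x hx
    obtain ⟨a, b⟩ := hball x hx
    rw [norm_smul]
    exact mul_le_mul_of_nonneg_left
      (norm_bidiscKernelFDeriv_le hδ0 a b hζ.1.le hζ.2.le) (norm_nonneg _)
  · filter_upwards [ae_bidiscMeasure_norm_lt_one] with ζ hζ x hx
    obtain ⟨a, b⟩ := hball x hx
    exact (hasFDerivAt_bidiscKernel (by linarith) (by linarith) hζ.1.le hζ.2.le).mul_const (F ζ)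

/-! ### Projection identities for functions holomorphic on D* × D. -/

theorem integrable_of_lintegral_sq_lt_top {α : Type*} [MeasurableSpace α] {μ : Measure α}
    [IsFiniteMeasure μ] {f : α → ℂ} (hf : AEStronglyMeasurable f μ)
    (h : ∫⁻ x, ‖f x‖ₑ ^ 2 ∂μ < ∞) : Integrable f μ := by
  have : MemLp f 2 μ := by
    refine ⟨hf, ?_⟩
    rw [eLpNorm_lt_top_iff_lintegral_rpow_enorm_lt_top (by simp) (by simp)]
    simpa using h
  exact this.integrable (by norm_num)

theorem ae_discMeasure_ne_zero : ∀ᵐ w ∂discMeasure, w ≠ 0 :=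
  ae_restrict_of_ae (Measure.ae_ne volume 0)

theorem ae_bidiscMeasure_fst_ne_zero : ∀ᵐ w ∂bidiscMeasure, w.1 ≠ 0 :=
  Measure.quasiMeasurePreserving_fst.ae ae_discMeasure_ne_zero

theorem radialAverage_congr_ae {h k : ℂ → ℂ} (hk : h =ᵐ[discMeasure] k) (w : ℂ) :
    radialAverage h w = radialAverage k w := by
  refine integral_congr_ae ?_
  filter_upwards [hk] with ζ hζ
  rw [hζ]

/-- The reproducing property for functions holomorphic on the punctured disc. -/
theorem integral_discKernel_mul_of_punctured {h : ℂ → ℂ}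
    (hd : DifferentiableOn ℂ h (ball 0 1 \ {0})) (hi : ∫⁻ z, ‖h z‖ₑ ^ 2 ∂discMeasure < ∞)
    {ζ : ℂ} (hζ : ‖ζ‖ < 1) (hζ0 : ζ ≠ 0) :
    ∫ w, discKernel ζ w * h w ∂discMeasure = h ζ := by
  obtain ⟨k, hk, hkh⟩ := exists_differentiableOn_of_lintegral_sq_lt_top hd hi
  have hae : k =ᵐ[discMeasure] h := by
    filter_upwards [ae_discMeasure_ne_zero] with w hw using hkh w hw
  have hki : Integrable k discMeasure := by
    refine integrable_of_lintegral_sq_lt_top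
      (hk.continuousOn.aestronglyMeasurable measurableSet_ball) ?_
    refine lt_of_eq_of_lt (lintegral_congr_ae ?_) hi
    filter_upwards [hae] with w hw
    rw [hw]
  rw [← hkh ζ hζ0, ← integral_discKernel_mul hk hki hζ]
  refine integral_congr_ae ?_
  filter_upwards [hae] with w hw
  rw [hw]

/-- A right inverse of the Bergman projection with values in functions that are `O(|w|²)`. -/
theorem integral_discKernel_mul_sq_mul_add_radialAverage {h : ℂ → ℂ}
    (hd : DifferentiableOn ℂ h (ball 0 1 \ {0})) (hi : ∫⁻ z, ‖h z‖ₑ ^ 2 ∂discMeasure < ∞)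
    {ζ : ℂ} (hζ : ‖ζ‖ < 1) (hζ0 : ζ ≠ 0) :
    ∫ w, discKernel ζ w * (‖w‖ ^ 2 * (h w + radialAverage h w)) ∂discMeasure = h ζ := by
  obtain ⟨k, hk, hkh⟩ := exists_differentiableOn_of_lintegral_sq_lt_top hd hi
  have hae : k =ᵐ[discMeasure] h := by
    filter_upwards [ae_discMeasure_ne_zero] with w hw using hkh w hw
  have hkm : AEStronglyMeasurable k discMeasure :=
    hk.continuousOn.aestronglyMeasurable measurableSet_ball
  have hk2 : ∫⁻ z, ‖k z‖ₑ ^ 2 ∂discMeasure < ∞ := by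
    refine lt_of_eq_of_lt (lintegral_congr_ae ?_) hi
    filter_upwards [hae] with w hw
    rw [hw]
  have hki := integrable_of_lintegral_sq_lt_top hkm hk2
  have hrd := differentiableOn_radialAverage hki
  have hri : Integrable (radialAverage k) discMeasure := by
    refine integrable_of_lintegral_sq_lt_top
      (hrd.continuousOn.aestronglyMeasurable measurableSet_ball) ?_
    obtain ⟨C, hC⟩ := exists_lintegral_enorm_radialAverage_rpow_le le_rfl
    have := hC k hkm
    simp only [ENNReal.rpow_ofNat] at this
    exact this.trans_lt (ENNReal.mul_lt_top ENNReal.coe_lt_top hk2)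
  rw [← hkh ζ hζ0, ← integral_discKernel_mul_sq_mul hk hrd
    (fun w hw => hasDerivAt_mul_radialAverage hk hki (mem_ball_zero_iff.1 hw)) hki hri hζ]
  refine integral_congr_ae ?_
  filter_upwards [hae] with w hw
  rw [hw, radialAverage_congr_ae hae]

/-- Functions on `D* × D` that are holomorphic in each variable. -/
structure IsSeparatelyHolomorphic (G : ℂ × ℂ → ℂ) : Prop where
  fst : ∀ w₂ : ℂ, ‖w₂‖ < 1 → DifferentiableOn ℂ (fun w₁ => G (w₁, w₂)) (ball 0 1 \ {0})
  snd : ∀ w₁ : ℂ, ‖w₁‖ < 1 → w₁ ≠ 0 → DifferentiableOn ℂ (fun w₂ => G (w₁, w₂)) (ball 0 1)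

theorem lintegral_bidiscMeasure {u : ℂ × ℂ → ℝ≥0∞} (hu : AEMeasurable u bidiscMeasure) :
    ∫⁻ w, u w ∂bidiscMeasure = ∫⁻ w₁, ∫⁻ w₂, u (w₁, w₂) ∂discMeasure ∂discMeasure :=
  lintegral_prod u hu

theorem lintegral_bidiscMeasure_symm {u : ℂ × ℂ → ℝ≥0∞} (hu : AEMeasurable u bidiscMeasure) :
    ∫⁻ w, u w ∂bidiscMeasure = ∫⁻ w₂, ∫⁻ w₁, u (w₁, w₂) ∂discMeasure ∂discMeasure :=
  lintegral_prod_symm u hu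

theorem ae_lintegral_sq_fst_lt_top {G : ℂ × ℂ → ℂ} (hG : AEStronglyMeasurable G bidiscMeasure)
    (h : ∫⁻ w, ‖G w‖ₑ ^ 2 ∂bidiscMeasure < ∞) :
    ∀ᵐ w₂ ∂discMeasure, ∫⁻ w₁, ‖G (w₁, w₂)‖ₑ ^ 2 ∂discMeasure < ∞ := by
  have hm : AEMeasurable (fun w => ‖G w‖ₑ ^ 2) bidiscMeasure := hG.enorm.pow_const 2
  rw [lintegral_bidiscMeasure_symm hm] at h
  exact ae_lt_top' (AEMeasurable.lintegral_prod_left' hm) h.ne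

theorem ae_lintegral_sq_snd_lt_top {G : ℂ × ℂ → ℂ} (hG : AEStronglyMeasurable G bidiscMeasure)
    (h : ∫⁻ w, ‖G w‖ₑ ^ 2 ∂bidiscMeasure < ∞) :
    ∀ᵐ w₁ ∂discMeasure, ∫⁻ w₂, ‖G (w₁, w₂)‖ₑ ^ 2 ∂discMeasure < ∞ := by
  have hm : AEMeasurable (fun w => ‖G w‖ₑ ^ 2) bidiscMeasure := hG.enorm.pow_const 2
  rw [lintegral_bidiscMeasure hm] at h
  exact ae_lt_top' (AEMeasurable.lintegral_prod_right' hm) h.ne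

/-- The Bergman projection of `F` is `G` if this holds in the first variable. -/
theorem bidiscProjection_ae_eq {F G : ℂ × ℂ → ℂ} (hF : Integrable F bidiscMeasure)
    (hG : IsSeparatelyHolomorphic G) (hGm : AEStronglyMeasurable G bidiscMeasure)
    (hG2 : ∫⁻ w, ‖G w‖ₑ ^ 2 ∂bidiscMeasure < ∞)
    (hFG : ∀ᵐ ζ₂ ∂discMeasure, ∀ w₁ : ℂ, ‖w₁‖ < 1 → w₁ ≠ 0 →
      ∫ ζ₁, discKernel w₁ ζ₁ * F (ζ₁, ζ₂) ∂discMeasure = G (w₁, ζ₂)) :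
    bidiscProjection F =ᵐ[bidiscMeasure] G := by
  have h2 := Measure.quasiMeasurePreserving_fst (μ := discMeasure) (ν := discMeasure) |>.ae
    (ae_lintegral_sq_snd_lt_top hGm hG2)
  filter_upwards [h2, ae_bidiscMeasure_norm_lt_one, ae_bidiscMeasure_fst_ne_zero] with w hw2 hw hw0
  have hd := hG.snd w.1 hw.1 hw0
  have hi := integrable_of_lintegral_sq_lt_top (μ := discMeasure)
    (hd.continuousOn.aestronglyMeasurable measurableSet_ball) hw2
  -- G(w₁, ·) is reproduced by the kernel in the second variable. By Fubini with ζ₁ innermost, the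
  -- inner integral of the left side is G(w₁, ζ₂) by `hFG`, so the two integrands in ζ₂ agree.
  rw [← integral_discKernel_mul hd hi hw.2, bidiscProjection, bidiscMeasure,
    integral_prod_symm _ (integrable_bidiscKernel_mul hw.1 hw.2 hF)]
  refine integral_congr_ae ?_
  filter_upwards [hFG] with ζ₂ hζ₂
  rw [← hζ₂ w.1 hw.1 hw0, ← integral_const_mul]
  refine integral_congr_ae (Eventually.of_forall fun ζ₁ => ?_)
  simp only [bidiscKernel]
  ring

theorem bidiscProjection_ae_eq_self {K : ℂ × ℂ → ℂ} (hK : IsSeparatelyHolomorphic K)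
    (hKm : AEStronglyMeasurable K bidiscMeasure) (hK2 : ∫⁻ w, ‖K w‖ₑ ^ 2 ∂bidiscMeasure < ∞) :
    bidiscProjection K =ᵐ[bidiscMeasure] K := by
  refine bidiscProjection_ae_eq (integrable_of_lintegral_sq_lt_top hKm hK2) hK hKm hK2 ?_
  filter_upwards [ae_discMeasure_norm_lt_one, ae_lintegral_sq_fst_lt_top hKm hK2] with ζ₂ h1 h2 w₁
    hw hw0
  exact integral_discKernel_mul_of_punctured (hK.fst ζ₂ h1) h2 hw hw0

/-- The kernel is Hermitian, so the operator is symmetric, and it fixes K. This is the orthogonality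
of F minus its projection to the holomorphic functions. -/
theorem integral_inner_bidiscProjection {F K : ℂ × ℂ → ℂ}
    (hFm : AEStronglyMeasurable F bidiscMeasure) (hF2 : ∫⁻ w, ‖F w‖ₑ ^ 2 ∂bidiscMeasure < ∞)
    (hK : IsSeparatelyHolomorphic K)
    (hKm : AEStronglyMeasurable K bidiscMeasure) (hK2 : ∫⁻ w, ‖K w‖ₑ ^ 2 ∂bidiscMeasure < ∞) :
    ∫ w, conj (bidiscProjection F w) * K w ∂bidiscMeasure
      = ∫ w, conj (F w) * K w ∂bidiscMeasure := by
  have hconj : Continuous fun z : ℂ => conj z := Complex.continuous_conj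
  have hint : Integrable (Function.uncurry fun w ζ => conj (bidiscKernel w ζ * F ζ) * K w)
      (bidiscMeasure.prod bidiscMeasure) := by
    have hm : AEStronglyMeasurable
        (Function.uncurry fun w ζ => conj (bidiscKernel w ζ * F ζ) * K w)
        (bidiscMeasure.prod bidiscMeasure) :=
      (hconj.comp_aestronglyMeasurable
        (measurable_bidiscKernel.aestronglyMeasurable.mul hFm.comp_snd)).mul hKm.comp_fst
    refine ⟨hm, ?_⟩
    rw [HasFiniteIntegral, lintegral_prod _ hm.enorm]
    -- Fubini needs absolute integrability of the double integral. The positive operator with kernel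
    -- |K(w, ζ)| is bounded on L² by the Schur test, and Cauchy–Schwarz against K concludes.
    set T : ℂ × ℂ → ℝ≥0∞ := fun w => ∫⁻ ζ, ‖bidiscKernel w ζ‖ₑ * ‖F ζ‖ₑ ∂bidiscMeasure with hT
    have hTm : AEMeasurable T bidiscMeasure :=
      AEMeasurable.lintegral_prod_right'
        (f := fun p : (ℂ × ℂ) × (ℂ × ℂ) => ‖bidiscKernel p.1 p.2‖ₑ * ‖F p.2‖ₑ)
        (measurable_bidiscKernel.enorm.aemeasurable.mul hFm.comp_snd.enorm)
    have hT2 : ∫⁻ w, T w ^ (2 : ℝ) ∂bidiscMeasure < ∞ := by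
      have hpq : (2 : ℝ).HolderConjugate 2 := Real.HolderConjugate.two_two
      refine (lintegral_lintegral_enorm_bidiscKernel_rpow_le hpq hFm.enorm).trans_lt ?_
      refine ENNReal.mul_lt_top (ENNReal.mul_lt_top ?_ ?_) (by simpa using hF2)
      · exact ENNReal.rpow_lt_top_of_nonneg (by norm_num) (ENNReal.pow_ne_top ENNReal.ofReal_ne_top)
      · exact ENNReal.pow_lt_top ENNReal.ofReal_lt_top
    calc _ = ∫⁻ w, (T * fun w => ‖K w‖ₑ) w ∂bidiscMeasure := by
          refine lintegral_congr fun w => ?_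
          simp only [Function.uncurry, enorm_mul, RCLike.enorm_conj, Pi.mul_apply, hT]
          rw [lintegral_mul_const' _ _ enorm_ne_top]
      _ ≤ _ := ENNReal.lintegral_mul_le_Lp_mul_Lq _ Real.HolderConjugate.two_two hTm hKm.enorm
      _ < ∞ := by
          refine ENNReal.mul_lt_top (ENNReal.rpow_lt_top_of_nonneg (by norm_num) hT2.ne)
            (ENNReal.rpow_lt_top_of_nonneg (by norm_num) ?_)
          simpa using hK2.ne
  have h1 : ∀ w, conj (bidiscProjection F w) * K w
      = ∫ ζ, conj (bidiscKernel w ζ * F ζ) * K w ∂bidiscMeasure := by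
    intro w
    rw [integral_mul_const, integral_conj, bidiscProjection]
  simp only [h1]
  rw [integral_integral_swap hint]
  refine integral_congr_ae ?_
  filter_upwards [bidiscProjection_ae_eq_self hK hKm hK2] with ζ hζ
  rw [← hζ, bidiscProjection, ← integral_const_mul]
  refine integral_congr_ae (Eventually.of_forall fun w => ?_)
  simp only [map_mul, bidiscKernel_conj]
  ring

/-! ### Change of variables between the bidisc and the Hartogs triangle. -/

theorem lintegral_comp_const_mul {c : ℂ} (hc : c ≠ 0) {u : ℂ → ℝ≥0∞} (hu : Measurable u) :
    ‖c‖ₑ ^ 2 * ∫⁻ w, u (c * w) = ∫⁻ w, u w := by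
  have hdet : LinearMap.det (LinearMap.mul ℝ ℂ c) = ‖c‖ ^ 2 := by
    have h := Algebra.norm_apply ℝ c
    rw [Algebra.norm_complex_apply, Complex.normSq_eq_norm_sq] at h
    exact h.symm
  have hc' : ‖c‖ ^ 2 ≠ 0 := by positivity
  have hmap := Measure.map_linearMap_addHaar_eq_smul_addHaar (volume : Measure ℂ)
    (f := LinearMap.mul ℝ ℂ c) (by rwa [hdet])
  have h1 : ∫⁻ w, u (c * w) = ∫⁻ w, u w ∂(Measure.map (LinearMap.mul ℝ ℂ c) volume) := by
    rw [lintegral_map hu (by exact (measurable_const_mul c))]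
    rfl
  rw [h1, hmap, hdet, lintegral_smul_measure, smul_eq_mul, ← mul_assoc, ← ofReal_norm,
    ← ENNReal.ofReal_pow (norm_nonneg _), ← ENNReal.ofReal_mul (by positivity),
    abs_of_nonneg (by positivity), mul_inv_cancel₀ hc', ENNReal.ofReal_one, one_mul]

/-- The biholomorphism from `D* × D` to the Hartogs triangle. -/
def hartogsMap (w : ℂ × ℂ) : ℂ × ℂ := (w.1, w.1 * w.2)

/-- The inverse of `hartogsMap`. -/
noncomputable def hartogsInv (z : ℂ × ℂ) : ℂ × ℂ := (z.1, z.2 / z.1)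

/-- The product of the punctured disc and the disc. -/
def puncturedBidisc : Set (ℂ × ℂ) := (ball 0 1 \ {0}) ×ˢ ball 0 1

theorem mem_puncturedBidisc {w : ℂ × ℂ} :
    w ∈ puncturedBidisc ↔ ‖w.1‖ < 1 ∧ w.1 ≠ 0 ∧ ‖w.2‖ < 1 := by
  simp [puncturedBidisc, and_assoc]

theorem isOpen_puncturedBidisc : IsOpen puncturedBidisc :=
  (isOpen_ball.sdiff isClosed_singleton).prod isOpen_ball

theorem measurable_hartogsMap : Measurable hartogsMap := by
  unfold hartogsMap
  fun_prop

theorem measurable_hartogsInv : Measurable hartogsInv := by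
  unfold hartogsInv
  fun_prop

theorem hartogsInv_hartogsMap {w : ℂ × ℂ} (hw : w.1 ≠ 0) : hartogsInv (hartogsMap w) = w := by
  simp [hartogsInv, hartogsMap, hw]

theorem hartogsMap_hartogsInv {z : ℂ × ℂ} (hz : z.1 ≠ 0) : hartogsMap (hartogsInv z) = z := by
  simp [hartogsInv, hartogsMap, mul_div_cancel₀, hz]

theorem fst_ne_zero_of_mem_hartogsTriangle {z : ℂ × ℂ} (hz : z ∈ hartogsTriangle) : z.1 ≠ 0 := by
  intro h
  have := hz.1
  rw [h, norm_zero] at this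
  exact absurd this (norm_nonneg _).not_gt

theorem hartogsMap_mem {w : ℂ × ℂ} (hw : w ∈ puncturedBidisc) : hartogsMap w ∈ hartogsTriangle := by
  obtain ⟨h1, h2, h3⟩ := mem_puncturedBidisc.1 hw
  refine ⟨?_, h1⟩
  simp only [hartogsMap, norm_mul]
  exact mul_lt_of_lt_one_right (norm_pos_iff.2 h2) h3

theorem hartogsInv_mem {z : ℂ × ℂ} (hz : z ∈ hartogsTriangle) : hartogsInv z ∈ puncturedBidisc := by
  have h0 := fst_ne_zero_of_mem_hartogsTriangle hz
  refine mem_puncturedBidisc.2 ⟨hz.2, h0, ?_⟩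
  simp only [hartogsInv, norm_div]
  exact (div_lt_one (norm_pos_iff.2 h0)).2 hz.1

theorem ae_mem_puncturedBidisc : ∀ᵐ w ∂bidiscMeasure, w ∈ puncturedBidisc := by
  filter_upwards [ae_bidiscMeasure_norm_lt_one, ae_bidiscMeasure_fst_ne_zero] with w h1 h2
  exact mem_puncturedBidisc.2 ⟨h1.1, h2, h1.2⟩

/-- By Tonelli it suffices to substitute z₂ = z₁w in each fibre z₁ ≠ 0. This is a complex scaling,
with real Jacobian |z₁|². -/
theorem setLIntegral_hartogsTriangle_of_measurable {u : ℂ × ℂ → ℝ≥0∞} (hu : Measurable u) :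
    ∫⁻ z in hartogsTriangle, u z = ∫⁻ w, ‖w.1‖ₑ ^ 2 * u (hartogsMap w) ∂bidiscMeasure := by
  have hH := isOpen_hartogsTriangle.measurableSet
  have hm : Measurable (hartogsTriangle.indicator u) := hu.indicator hH
  have hm2 : Measurable fun w : ℂ × ℂ => ‖w.1‖ₑ ^ 2 * u (hartogsMap w) :=
    (by fun_prop : Measurable fun w : ℂ × ℂ => ‖w.1‖ₑ ^ 2).mul (hu.comp measurable_hartogsMap)
  rw [lintegral_bidiscMeasure hm2.aemeasurable, ← lintegral_indicator hH, Measure.volume_eq_prod,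
    lintegral_prod _ hm.aemeasurable, discMeasure, ← lintegral_indicator measurableSet_ball]
  refine lintegral_congr_ae ?_
  filter_upwards [Measure.ae_ne volume (0 : ℂ)] with z₁ hz
  by_cases h1 : z₁ ∈ ball (0 : ℂ) 1
  · rw [indicator_of_mem h1, ← lintegral_indicator measurableSet_ball,
      ← lintegral_comp_const_mul hz (u := fun y => hartogsTriangle.indicator u (z₁, y))
        (hm.comp measurable_prodMk_left),
      ← lintegral_const_mul' _ _ (by simp)]
    refine lintegral_congr fun w => ?_
    have hiff : (z₁, z₁ * w) ∈ hartogsTriangle ↔ w ∈ ball (0 : ℂ) 1 := by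
      rw [mem_ball_zero_iff] at h1 ⊢
      have : 0 < ‖z₁‖ := norm_pos_iff.2 hz
      simp only [hartogsTriangle, mem_ofPred_eq, norm_mul, h1, and_true]
      exact mul_lt_iff_lt_one_right this
    by_cases hw : w ∈ ball (0 : ℂ) 1
    · rw [indicator_of_mem hw, indicator_of_mem (hiff.2 hw), hartogsMap]
    · rw [indicator_of_notMem hw, indicator_of_notMem (fun h => hw (hiff.1 h)), mul_zero]
  · rw [indicator_of_notMem h1]
    refine (lintegral_congr fun z₂ => ?_).trans lintegral_zero
    refine indicator_of_notMem (fun h => h1 ?_) _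
    exact mem_ball_zero_iff.2 h.2

/-- The pullback of Lebesgue measure of the Hartogs triangle to the bidisc. -/
noncomputable def hartogsPullback : Measure (ℂ × ℂ) :=
  bidiscMeasure.withDensity fun w => ((‖w.1‖₊ ^ 2 : ℝ≥0) : ℝ≥0∞)

/-- As an identity of measures, the substitution extends to a.e. measurable integrands and to
Bochner integrals. As the density |w₁|² vanishes only on a null set, null sets also transfer in both
directions. -/
theorem map_hartogsMap : hartogsPullback.map hartogsMap = volume.restrict hartogsTriangle := by
  ext s hs
  have h := setLIntegral_hartogsTriangle_of_measurable (measurable_const.indicator hs :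
    Measurable (s.indicator fun _ => (1 : ℝ≥0∞)))
  rw [lintegral_indicator hs, setLIntegral_one] at h
  rw [h, Measure.map_apply measurable_hartogsMap hs, hartogsPullback,
    withDensity_apply _ (measurable_hartogsMap hs), ← lintegral_indicator (measurable_hartogsMap hs)]
  refine lintegral_congr fun w => ?_
  by_cases hw : w ∈ hartogsMap ⁻¹' s
  · rw [indicator_of_mem hw, indicator_of_mem (show hartogsMap w ∈ s from hw), mul_one,
      ENNReal.coe_pow]
    rfl
  · rw [indicator_of_notMem hw, indicator_of_notMem (show hartogsMap w ∉ s from hw), mul_zero]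

theorem measurable_hartogsDensity : Measurable fun w : ℂ × ℂ => (‖w.1‖₊ ^ 2 : ℝ≥0) := by
  fun_prop

theorem bidiscMeasure_absolutelyContinuous : bidiscMeasure ≪ hartogsPullback := by
  refine withDensity_absolutelyContinuous' measurable_hartogsDensity.coe_nnreal_ennreal.aemeasurable ?_
  filter_upwards [ae_bidiscMeasure_fst_ne_zero] with w hw
  simpa using hw

theorem quasiMeasurePreserving_hartogsMap :
    Measure.QuasiMeasurePreserving hartogsMap bidiscMeasure (volume.restrict hartogsTriangle) :=
  ⟨measurable_hartogsMap, by
    rw [← map_hartogsMap]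
    exact bidiscMeasure_absolutelyContinuous.map measurable_hartogsMap⟩

theorem quasiMeasurePreserving_hartogsInv :
    Measure.QuasiMeasurePreserving hartogsInv (volume.restrict hartogsTriangle) bidiscMeasure := by
  refine ⟨measurable_hartogsInv, ?_⟩
  have h1 : hartogsInv ∘ hartogsMap =ᵐ[hartogsPullback] id := by
    refine (withDensity_absolutelyContinuous _ _ : hartogsPullback ≪ bidiscMeasure).ae_le ?_
    filter_upwards [ae_bidiscMeasure_fst_ne_zero] with w hw using hartogsInv_hartogsMap hw
  rw [← map_hartogsMap, Measure.map_map measurable_hartogsInv measurable_hartogsMap,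
    Measure.map_congr h1, Measure.map_id]
  exact withDensity_absolutelyContinuous _ _

theorem setLIntegral_hartogsTriangle {u : ℂ × ℂ → ℝ≥0∞}
    (hu : AEMeasurable u (volume.restrict hartogsTriangle)) :
    ∫⁻ z in hartogsTriangle, u z = ∫⁻ w, ‖w.1‖ₑ ^ 2 * u (hartogsMap w) ∂bidiscMeasure := by
  rw [← map_hartogsMap] at hu ⊢
  rw [lintegral_map' hu measurable_hartogsMap.aemeasurable, hartogsPullback,
    lintegral_withDensity_eq_lintegral_mul_non_measurable _
      measurable_hartogsDensity.coe_nnreal_ennreal (by simp)]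
  refine lintegral_congr fun w => ?_
  rw [Pi.mul_apply, ENNReal.coe_pow]
  rfl

theorem setIntegral_hartogsTriangle {u : ℂ × ℂ → ℂ}
    (hu : AEStronglyMeasurable u (volume.restrict hartogsTriangle)) :
    ∫ z in hartogsTriangle, u z = ∫ w, (‖w.1‖ ^ 2 : ℂ) * u (hartogsMap w) ∂bidiscMeasure := by
  rw [← map_hartogsMap] at hu ⊢
  rw [integral_map measurable_hartogsMap.aemeasurable hu, hartogsPullback,
    integral_withDensity_eq_integral_smul measurable_hartogsDensity]
  refine integral_congr_ae (Eventually.of_forall fun w => ?_)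
  simp [NNReal.smul_def]

/-- The function `w₁ f(w₁, w₁ w₂)` on `D* × D`, extended by zero. -/
noncomputable def bidiscLift (f : ℂ × ℂ → ℂ) : ℂ × ℂ → ℂ :=
  puncturedBidisc.indicator fun w => w.1 * f (hartogsMap w)

/-- The function `F(z₁, z₂ / z₁) / z₁` on the Hartogs triangle. -/
noncomputable def hartogsDescent (F : ℂ × ℂ → ℂ) (z : ℂ × ℂ) : ℂ := z.1⁻¹ * F (hartogsInv z)

theorem bidiscLift_ae_eq (f : ℂ × ℂ → ℂ) :
    bidiscLift f =ᵐ[bidiscMeasure] fun w => w.1 * f (hartogsMap w) := by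
  filter_upwards [ae_mem_puncturedBidisc] with w hw using indicator_of_mem hw _

theorem bidiscLift_hartogsDescent_ae_eq (F : ℂ × ℂ → ℂ) :
    bidiscLift (hartogsDescent F) =ᵐ[bidiscMeasure] F := by
  filter_upwards [bidiscLift_ae_eq (hartogsDescent F), ae_bidiscMeasure_fst_ne_zero] with w hw h0
  rw [hw, hartogsDescent, hartogsInv_hartogsMap h0]
  simp [hartogsMap, h0]

theorem hartogsDescent_bidiscLift {f : ℂ × ℂ → ℂ} {z : ℂ × ℂ} (hz : z ∈ hartogsTriangle) :
    hartogsDescent (bidiscLift f) z = f z := by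
  have h0 := fst_ne_zero_of_mem_hartogsTriangle hz
  rw [hartogsDescent, bidiscLift, indicator_of_mem (hartogsInv_mem hz), hartogsMap_hartogsInv h0]
  simp [hartogsInv, h0]

theorem hartogsDescent_congr_ae {F G : ℂ × ℂ → ℂ} (h : F =ᵐ[bidiscMeasure] G) :
    hartogsDescent F =ᵐ[volume.restrict hartogsTriangle] hartogsDescent G := by
  filter_upwards [quasiMeasurePreserving_hartogsInv.ae h] with z hz
  rw [hartogsDescent, hartogsDescent, hz]

theorem aestronglyMeasurable_bidiscLift {f : ℂ × ℂ → ℂ}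
    (hf : AEStronglyMeasurable f (volume.restrict hartogsTriangle)) :
    AEStronglyMeasurable (bidiscLift f) bidiscMeasure :=
  (continuous_fst.aestronglyMeasurable.mul
    (hf.comp_quasiMeasurePreserving quasiMeasurePreserving_hartogsMap)).congr
    (bidiscLift_ae_eq f).symm

theorem aestronglyMeasurable_hartogsDescent {F : ℂ × ℂ → ℂ}
    (hF : AEStronglyMeasurable F bidiscMeasure) :
    AEStronglyMeasurable (hartogsDescent F) (volume.restrict hartogsTriangle) :=
  (measurable_fst.inv.aestronglyMeasurable).mul
    (hF.comp_quasiMeasurePreserving quasiMeasurePreserving_hartogsInv)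

theorem differentiableOn_mul_comp_hartogsMap {g : ℂ × ℂ → ℂ}
    (hg : DifferentiableOn ℂ g hartogsTriangle) :
    DifferentiableOn ℂ (fun w => w.1 * g (hartogsMap w)) puncturedBidisc := by
  refine differentiableOn_fst.mul (hg.comp ?_ fun w hw => hartogsMap_mem hw)
  unfold hartogsMap
  fun_prop

theorem measurable_bidiscLift {g : ℂ × ℂ → ℂ} (hg : DifferentiableOn ℂ g hartogsTriangle) :
    Measurable (bidiscLift g) := by
  classical
  have := (differentiableOn_mul_comp_hartogsMap hg).continuousOn.measurable_piecewise
    (g := fun _ => (0 : ℂ)) continuousOn_const isOpen_puncturedBidisc.measurableSet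
  rw [bidiscLift, ← Set.piecewise_eq_indicator]
  exact this

theorem isSeparatelyHolomorphic_bidiscLift {g : ℂ × ℂ → ℂ}
    (hg : DifferentiableOn ℂ g hartogsTriangle) : IsSeparatelyHolomorphic (bidiscLift g) := by
  have hd : DifferentiableOn ℂ (bidiscLift g) puncturedBidisc :=
    (differentiableOn_mul_comp_hartogsMap hg).congr fun w hw => indicator_of_mem hw _
  refine ⟨fun w₂ h2 => hd.comp (f := fun w₁ => (w₁, w₂)) (by fun_prop) fun w₁ h1 => ?_,
    fun w₁ h1 h0 => hd.comp (f := fun w₂ => (w₁, w₂)) (by fun_prop) fun w₂ h2 => ?_⟩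
  · exact mem_puncturedBidisc.2 ⟨mem_ball_zero_iff.1 h1.1, h1.2, h2⟩
  · exact mem_puncturedBidisc.2 ⟨h1, h0, mem_ball_zero_iff.1 h2⟩

/-- This is where the weight comes from: |w₁|^p = |w₁|² · |w₁|^(p-2), where the first factor is the
Jacobian and the second is δ₁^(p-2). For p = 2 the lift is an isometry of the unweighted spaces. -/
theorem lintegral_enorm_bidiscLift_rpow {p : ℝ} (hp : 2 ≤ p) {f : ℂ × ℂ → ℂ}
    (hf : AEStronglyMeasurable f (volume.restrict hartogsTriangle)) :
    ∫⁻ w, ‖bidiscLift f w‖ₑ ^ p ∂bidiscMeasure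
      = ∫⁻ z in hartogsTriangle, ‖f z‖ₑ ^ p * ENNReal.ofReal (delta1 z ^ (p - 2)) := by
  have hdm : Measurable fun z => ENNReal.ofReal (delta1 z ^ (p - 2)) := by
    unfold delta1
    fun_prop
  rw [setLIntegral_hartogsTriangle
    (AEMeasurable.fun_mul (hf.enorm.pow_const p) hdm.aemeasurable)]
  refine lintegral_congr_ae ?_
  filter_upwards [bidiscLift_ae_eq f, ae_bidiscMeasure_fst_ne_zero] with w hw h0
  have hpos : 0 < ‖w.1‖ := norm_pos_iff.2 h0
  have h1 : ‖w.1‖ₑ ^ p = ‖w.1‖ₑ ^ 2 * ENNReal.ofReal (‖w.1‖ ^ (p - 2)) := by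
    rw [← ofReal_norm, ENNReal.ofReal_rpow_of_pos hpos, ← ENNReal.ofReal_pow hpos.le,
      ← ENNReal.ofReal_mul (by positivity), ← Real.rpow_natCast, ← Real.rpow_add hpos]
    norm_num
  rw [hw, enorm_mul, ENNReal.mul_rpow_of_nonneg _ _ (by linarith), h1]
  simp only [delta1, hartogsMap]
  ring

theorem lintegral_enorm_bidiscLift_sq {f : ℂ × ℂ → ℂ}
    (hf : AEStronglyMeasurable f (volume.restrict hartogsTriangle)) :
    ∫⁻ w, ‖bidiscLift f w‖ₑ ^ 2 ∂bidiscMeasure = ∫⁻ z in hartogsTriangle, ‖f z‖ₑ ^ 2 := by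
  simpa using lintegral_enorm_bidiscLift_rpow le_rfl hf

theorem lintegral_enorm_bidiscLift_rpow_le {p : ℝ} (hp : 2 ≤ p) {f : ℂ × ℂ → ℂ}
    (hf : AEStronglyMeasurable f (volume.restrict hartogsTriangle)) :
    ∫⁻ w, ‖bidiscLift f w‖ₑ ^ p ∂bidiscMeasure ≤ ∫⁻ z in hartogsTriangle, ‖f z‖ₑ ^ p := by
  rw [lintegral_enorm_bidiscLift_rpow hp hf]
  refine setLIntegral_mono' isOpen_hartogsTriangle.measurableSet fun z hz => ?_
  refine mul_le_of_le_one_right' (ENNReal.ofReal_le_one.2 ?_)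
  exact Real.rpow_le_one (norm_nonneg _) hz.2.le (by linarith)

/-- Descent divides by w₁, which the factor |w₁|² outweighs: |w₁|⁻¹|w₁|² = |w₁| ≤ 1, and the
Jacobian is also at most 1. No weight is lost, which is what surjectivity requires. -/
theorem lintegral_enorm_hartogsDescent_rpow_le {p : ℝ} (hp : 2 ≤ p) {M : ℂ × ℂ → ℂ}
    (hM : AEStronglyMeasurable M bidiscMeasure) :
    ∫⁻ z in hartogsTriangle, ‖hartogsDescent (fun w => (‖w.1‖ ^ 2 : ℂ) * M w) z‖ₑ ^ p
      ≤ ∫⁻ w, ‖M w‖ₑ ^ p ∂bidiscMeasure := by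
  have hm : AEStronglyMeasurable (fun w : ℂ × ℂ => (‖w.1‖ ^ 2 : ℂ) * M w) bidiscMeasure :=
    AEStronglyMeasurable.mul (by fun_prop) hM
  rw [setLIntegral_hartogsTriangle ((aestronglyMeasurable_hartogsDescent hm).enorm.pow_const p)]
  refine lintegral_mono_ae ?_
  filter_upwards [ae_mem_puncturedBidisc] with w hw
  obtain ⟨h1, h0, -⟩ := mem_puncturedBidisc.1 hw
  rw [hartogsDescent, hartogsInv_hartogsMap h0]
  have h2 : ‖w.1‖ₑ ≤ 1 := by
    rw [← ofReal_norm]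
    exact ENNReal.ofReal_le_one.2 h1.le
  have h3 : ‖(hartogsMap w).1⁻¹ * ((‖w.1‖ ^ 2 : ℂ) * M w)‖ₑ ≤ ‖M w‖ₑ := by
    have hpos : 0 < ‖w.1‖ := norm_pos_iff.2 h0
    refine enorm_le_iff_norm_le.2 ?_
    simp only [hartogsMap, norm_mul, norm_inv, norm_pow, Complex.norm_real, norm_norm]
    rw [← mul_assoc]
    refine mul_le_of_le_one_left (norm_nonneg _) ?_
    rw [pow_two, ← mul_assoc, inv_mul_cancel₀ hpos.ne', one_mul]
    exact h1.le
  calc _ ≤ 1 ^ 2 * ‖M w‖ₑ ^ p := by gcongr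
    _ = _ := by rw [one_pow, one_mul]

/-! ### Identification and boundedness of the Bergman projection of the triangle. -/

theorem memLp_ofReal_of_lintegral_lt_top {α : Type*} [MeasurableSpace α] {μ : Measure α} {p : ℝ}
    (hp : 0 < p) {f : α → ℂ} (hf : AEStronglyMeasurable f μ)
    (h : ∫⁻ x, ‖f x‖ₑ ^ p ∂μ < ∞) : MemLp f (ENNReal.ofReal p) μ := by
  refine ⟨hf, ?_⟩
  rw [eLpNorm_lt_top_iff_lintegral_rpow_enorm_lt_top (by simpa using hp) (by simp),
    ENNReal.toReal_ofReal hp.le]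
  exact h

theorem lintegral_sq_lt_top_of_memLp {α : Type*} [MeasurableSpace α] {μ : Measure α} {f : α → ℂ}
    (hf : MemLp f 2 μ) : ∫⁻ x, ‖f x‖ₑ ^ 2 ∂μ < ∞ := by
  have := (eLpNorm_lt_top_iff_lintegral_rpow_enorm_lt_top (by simp) (by simp)).1 hf.2
  simpa using this

theorem memLp_two_of_lintegral_sq_lt_top {α : Type*} [MeasurableSpace α] {μ : Measure α}
    {f : α → ℂ} (hf : AEStronglyMeasurable f μ) (h : ∫⁻ x, ‖f x‖ₑ ^ 2 ∂μ < ∞) : MemLp f 2 μ := by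
  refine ⟨hf, ?_⟩
  rw [eLpNorm_lt_top_iff_lintegral_rpow_enorm_lt_top (by simp) (by simp)]
  simpa using h

theorem aestronglyMeasurable_bidiscProjection {F : ℂ × ℂ → ℂ} (hF : Integrable F bidiscMeasure) :
    AEStronglyMeasurable (bidiscProjection F) bidiscMeasure := by
  have hc : ContinuousOn (bidiscProjection F) (ball 0 1 ×ˢ ball 0 1) := fun w hw =>
    (differentiableAt_bidiscProjection hF (mem_ball_zero_iff.1 hw.1)
      (mem_ball_zero_iff.1 hw.2)).continuousAt.continuousWithinAt
  have := hc.aestronglyMeasurable (μ := volume) (measurableSet_ball.prod measurableSet_ball)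
  rwa [Measure.volume_eq_prod, ← Measure.prod_restrict] at this

theorem lintegral_enorm_bidiscProjection_sq_lt_top {F : ℂ × ℂ → ℂ}
    (hF : AEStronglyMeasurable F bidiscMeasure) (h2 : ∫⁻ w, ‖F w‖ₑ ^ 2 ∂bidiscMeasure < ∞) :
    ∫⁻ w, ‖bidiscProjection F w‖ₑ ^ 2 ∂bidiscMeasure < ∞ := by
  obtain ⟨C, hC⟩ := exists_lintegral_enorm_bidiscProjection_rpow_le le_rfl
  have := hC F hF
  simp only [ENNReal.rpow_ofNat] at this
  exact this.trans_lt (ENNReal.mul_lt_top ENNReal.coe_lt_top h2)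

theorem differentiableOn_hartogsDescent_bidiscProjection {F : ℂ × ℂ → ℂ}
    (hF : Integrable F bidiscMeasure) :
    DifferentiableOn ℂ (hartogsDescent (bidiscProjection F)) hartogsTriangle := by
  intro z hz
  obtain ⟨h1, h0, h2⟩ := mem_puncturedBidisc.1 (hartogsInv_mem hz)
  have h0' : z.1 ≠ 0 := h0
  have hinv : DifferentiableAt ℂ hartogsInv z := by
    have := (differentiableAt_snd (𝕜 := ℂ) (p := z)).fun_mul (differentiableAt_fst.fun_inv h0')
    simp only [← div_eq_mul_inv] at this
    exact differentiableAt_fst.prodMk this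
  have hP := (differentiableAt_bidiscProjection hF h1 h2).comp z hinv
  exact ((differentiableAt_fst.inv h0').mul hP).differentiableWithinAt

theorem integral_inner_eq_bidiscMeasure {f k : ℂ × ℂ → ℂ}
    (hf : AEStronglyMeasurable f (volume.restrict hartogsTriangle))
    (hk : AEStronglyMeasurable k (volume.restrict hartogsTriangle)) :
    ∫ z in hartogsTriangle, conj (f z) * k z
      = ∫ w, conj (bidiscLift f w) * bidiscLift k w ∂bidiscMeasure := by
  have hm : AEStronglyMeasurable (fun z => conj (f z) * k z) (volume.restrict hartogsTriangle) :=
    (Complex.continuous_conj.comp_aestronglyMeasurable hf).mul hk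
  rw [setIntegral_hartogsTriangle hm]
  refine integral_congr_ae ?_
  filter_upwards [bidiscLift_ae_eq f, bidiscLift_ae_eq k] with w h1 h2
  rw [h1, h2, map_mul]
  have : conj w.1 * w.1 = (‖w.1‖ ^ 2 : ℂ) := by
    rw [mul_comm, Complex.mul_conj, Complex.normSq_eq_norm_sq]
    push_cast
    rfl
  rw [← this]
  ring

/-- The Bergman projection of the Hartogs triangle as an integral operator on the bidisc. -/
theorem hartogsBergmanProjection_ae_eq {f : ℂ × ℂ → ℂ}
    (hf : MemLp f 2 (volume.restrict hartogsTriangle)) :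
    hartogsBergmanProjection (hf.toLp f) =ᵐ[volume.restrict hartogsTriangle]
      hartogsDescent (bidiscProjection (bidiscLift f)) := by
  have hFm := aestronglyMeasurable_bidiscLift hf.1
  have hF2 : ∫⁻ w, ‖bidiscLift f w‖ₑ ^ 2 ∂bidiscMeasure < ∞ := by
    rw [lintegral_enorm_bidiscLift_sq hf.1]
    exact lintegral_sq_lt_top_of_memLp hf
  have hFi := integrable_of_lintegral_sq_lt_top hFm hF2
  have hPm := aestronglyMeasurable_bidiscProjection hFi
  have hP2 := lintegral_enorm_bidiscProjection_sq_lt_top hFm hF2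
  set g := hartogsDescent (bidiscProjection (bidiscLift f)) with hg
  have hgd : DifferentiableOn ℂ g hartogsTriangle :=
    differentiableOn_hartogsDescent_bidiscProjection hFi
  have hgm : AEStronglyMeasurable g (volume.restrict hartogsTriangle) :=
    aestronglyMeasurable_hartogsDescent hPm
  have hlift : bidiscLift g =ᵐ[bidiscMeasure] bidiscProjection (bidiscLift f) :=
    bidiscLift_hartogsDescent_ae_eq _
  have hgL : MemLp g 2 (volume.restrict hartogsTriangle) := by
    refine memLp_two_of_lintegral_sq_lt_top hgm ?_
    rw [← lintegral_enorm_bidiscLift_sq hgm]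
    refine lt_of_eq_of_lt (lintegral_congr_ae ?_) hP2
    filter_upwards [hlift] with w hw
    rw [hw]
  have hproj : hartogsBergmanProjection (hf.toLp f) = hgL.toLp g := by
    -- The candidate g lies in the Bergman space, so it remains to see that f - g is orthogonal to
    -- every k there. After lifting, this is `integral_inner_bidiscProjection`.
    refine Submodule.eq_starProjection_of_mem_of_inner_eq_zero ⟨g, hgd, hgL.coeFn_toLp⟩ ?_
    rintro k ⟨k', hkd, hk⟩
    have hk'm : AEStronglyMeasurable k' (volume.restrict hartogsTriangle) :=
      (Lp.aestronglyMeasurable k).congr hk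
    have hk'L : MemLp k' 2 (volume.restrict hartogsTriangle) := (Lp.memLp k).ae_eq hk
    have hK2 : ∫⁻ w, ‖bidiscLift k' w‖ₑ ^ 2 ∂bidiscMeasure < ∞ := by
      rw [lintegral_enorm_bidiscLift_sq hk'm]
      exact lintegral_sq_lt_top_of_memLp hk'L
    have key := integral_inner_bidiscProjection hFm hF2 (isSeparatelyHolomorphic_bidiscLift hkd)
      (measurable_bidiscLift hkd).aestronglyMeasurable hK2
    have e1 : ∀ {u : ℂ × ℂ → ℂ} (hu : MemLp u 2 (volume.restrict hartogsTriangle)),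
        inner ℂ (hu.toLp u) k = ∫ w, conj (bidiscLift u w) * bidiscLift k' w ∂bidiscMeasure := by
      intro u hu
      rw [L2.inner_def, ← integral_inner_eq_bidiscMeasure hu.1 hk'm]
      refine integral_congr_ae ?_
      filter_upwards [hu.coeFn_toLp, hk] with z h1 h2
      rw [h1, h2, RCLike.inner_apply']
    rw [inner_sub_left, e1 hf, e1 hgL, ← key, sub_eq_zero]
    refine integral_congr_ae ?_
    filter_upwards [hlift] with w hw
    rw [hw]
  rw [hproj]
  exact hgL.coeFn_toLp

theorem exists_bound_hartogsBergmanProjection {p : ℝ} (hp : 2 ≤ p) :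
    ∃ C : ℝ≥0, ∀ (f : ℂ × ℂ → ℂ)
        (hf : MemLp f (ENNReal.ofReal p) (volume.restrict hartogsTriangle)),
      ∃ g ∈ weightedBergmanSpace hartogsTriangle p (fun z => delta1 z ^ (p - 2)),
        hartogsBergmanProjection ((memLp_two_of_memLp hp hf).toLp f)
            =ᵐ[volume.restrict hartogsTriangle] g ∧
          weightedLpNorm hartogsTriangle p (fun z => delta1 z ^ (p - 2)) g
            ≤ C * eLpNorm f (ENNReal.ofReal p) (volume.restrict hartogsTriangle) := by
  obtain ⟨C, hC⟩ := exists_lintegral_enorm_bidiscProjection_rpow_le hp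
  have hp0 : 0 < p := by linarith
  refine ⟨C ^ (1 / p), fun f hf => ?_⟩
  have hf2 := memLp_two_of_memLp hp hf
  have hFm := aestronglyMeasurable_bidiscLift hf.1
  have hF2 : ∫⁻ w, ‖bidiscLift f w‖ₑ ^ 2 ∂bidiscMeasure < ∞ := by
    rw [lintegral_enorm_bidiscLift_sq hf.1]
    exact lintegral_sq_lt_top_of_memLp hf2
  have hFi := integrable_of_lintegral_sq_lt_top hFm hF2
  have hgm := aestronglyMeasurable_hartogsDescent (aestronglyMeasurable_bidiscProjection hFi)
  have hbound : weightedLpNorm hartogsTriangle p (fun z => delta1 z ^ (p - 2))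
      (hartogsDescent (bidiscProjection (bidiscLift f)))
      ≤ (C ^ (1 / p) : ℝ≥0) * eLpNorm f (ENNReal.ofReal p) (volume.restrict hartogsTriangle) := by
    have e1 : ∫⁻ w, ‖bidiscLift (hartogsDescent (bidiscProjection (bidiscLift f))) w‖ₑ ^ p
        ∂bidiscMeasure = ∫⁻ w, ‖bidiscProjection (bidiscLift f) w‖ₑ ^ p ∂bidiscMeasure := by
      refine lintegral_congr_ae ?_
      filter_upwards [bidiscLift_hartogsDescent_ae_eq (bidiscProjection (bidiscLift f))] with w hw
      rw [hw]
    rw [weightedLpNorm, ← lintegral_enorm_bidiscLift_rpow hp hgm, e1,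
      eLpNorm_eq_lintegral_rpow_enorm_toReal (by simpa using hp0) (by simp),
      ENNReal.toReal_ofReal hp0.le, ENNReal.coe_rpow_of_nonneg _ (by positivity),
      ← ENNReal.mul_rpow_of_nonneg _ _ (by positivity)]
    refine ENNReal.rpow_le_rpow ((hC _ hFm).trans ?_) (by positivity)
    exact mul_le_mul_right (lintegral_enorm_bidiscLift_rpow_le hp hf.1) _
  refine ⟨_, ⟨differentiableOn_hartogsDescent_bidiscProjection hFi, ?_⟩,
    hartogsBergmanProjection_ae_eq hf2, hbound⟩
  exact hbound.trans_lt (ENNReal.mul_lt_top ENNReal.coe_lt_top hf.2)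

/-! ### Surjectivity. -/

theorem aestronglyMeasurable_radialAverage {G : ℂ × ℂ → ℂ} (hG : Measurable G) :
    AEStronglyMeasurable (fun w : ℂ × ℂ => radialAverage (fun ζ => G (ζ, w.2)) w.1)
      bidiscMeasure := by
  have hconj : Measurable fun ζ : ℂ => conj ζ := Complex.continuous_conj.measurable
  have h1 : Measurable fun q : (ℂ × ℂ) × ℂ => (Real.pi * (1 - q.1.1 * conj q.2))⁻¹ := by
    fun_prop
  have h2 : Measurable fun q : (ℂ × ℂ) × ℂ => G (q.2, q.1.2) :=
    hG.comp (by fun_prop : Measurable fun q : (ℂ × ℂ) × ℂ => (q.2, q.1.2))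
  have h3 := (h1.mul h2).stronglyMeasurable.integral_prod_right' (ν := discMeasure)
  exact h3.aestronglyMeasurable

theorem lintegral_enorm_radialAverage_rpow_lt_top {p : ℝ} (hp : 2 ≤ p) {G : ℂ × ℂ → ℂ}
    (hG : Measurable G) (hGp : ∫⁻ w, ‖G w‖ₑ ^ p ∂bidiscMeasure < ∞) :
    ∫⁻ w, ‖radialAverage (fun ζ => G (ζ, w.2)) w.1‖ₑ ^ p ∂bidiscMeasure < ∞ := by
  obtain ⟨C, hC⟩ := exists_lintegral_enorm_radialAverage_rpow_le hp
  have hm := (aestronglyMeasurable_radialAverage hG).enorm.pow_const p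
  rw [lintegral_bidiscMeasure_symm hm]
  rw [lintegral_bidiscMeasure_symm (hG.enorm.pow_const p).aemeasurable] at hGp
  calc _ ≤ ∫⁻ w₂, C * ∫⁻ w₁, ‖G (w₁, w₂)‖ₑ ^ p ∂discMeasure ∂discMeasure :=
        lintegral_mono fun w₂ => hC (fun ζ => G (ζ, w₂))
          (hG.comp measurable_prodMk_right).aestronglyMeasurable
    _ = C * ∫⁻ w₂, ∫⁻ w₁, ‖G (w₁, w₂)‖ₑ ^ p ∂discMeasure ∂discMeasure :=
        lintegral_const_mul' _ _ ENNReal.coe_ne_top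
    _ < ∞ := ENNReal.mul_lt_top ENNReal.coe_lt_top hGp

theorem exists_hartogsBergmanProjection_eq {p : ℝ} (hp : 2 ≤ p) {g : ℂ × ℂ → ℂ}
    (hg : g ∈ weightedBergmanSpace hartogsTriangle p (fun z => delta1 z ^ (p - 2))) :
    ∃ (f : ℂ × ℂ → ℂ) (hf : MemLp f (ENNReal.ofReal p) (volume.restrict hartogsTriangle)),
      hartogsBergmanProjection ((memLp_two_of_memLp hp hf).toLp f)
        =ᵐ[volume.restrict hartogsTriangle] g := by
  obtain ⟨hgd, hgp⟩ := hg
  have hp0 : 0 < p := by linarith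
  have hgm : AEStronglyMeasurable g (volume.restrict hartogsTriangle) :=
    hgd.continuousOn.aestronglyMeasurable isOpen_hartogsTriangle.measurableSet
  rw [weightedLpNorm, ← lintegral_enorm_bidiscLift_rpow hp hgm,
    ENNReal.rpow_lt_top_iff_of_pos (by positivity)] at hgp
  set G := bidiscLift g with hG
  have hGm : Measurable G := measurable_bidiscLift hgd
  have hGs : IsSeparatelyHolomorphic G := isSeparatelyHolomorphic_bidiscLift hgd
  have h2p : 2 ≤ ENNReal.ofReal p := by simpa using ENNReal.ofReal_le_ofReal hp
  have hGL : MemLp G (ENNReal.ofReal p) bidiscMeasure :=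
    memLp_ofReal_of_lintegral_lt_top hp0 hGm.aestronglyMeasurable hgp
  have hG2 : ∫⁻ w, ‖G w‖ₑ ^ 2 ∂bidiscMeasure < ∞ :=
    lintegral_sq_lt_top_of_memLp (hGL.mono_exponent h2p)
  -- The one-variable right inverse is applied in w₁ only, with w₂ as a parameter: division by z₁ is
  -- the sole obstruction to membership in L^p, and G is already holomorphic in w₂.
  set M : ℂ × ℂ → ℂ := fun w => G w + radialAverage (fun ζ => G (ζ, w.2)) w.1 with hM
  have hML : MemLp M (ENNReal.ofReal p) bidiscMeasure :=
    hGL.add (memLp_ofReal_of_lintegral_lt_top hp0 (aestronglyMeasurable_radialAverage hGm)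
      (lintegral_enorm_radialAverage_rpow_lt_top hp hGm hgp))
  have hMp : ∫⁻ w, ‖M w‖ₑ ^ p ∂bidiscMeasure < ∞ := by
    have := (eLpNorm_lt_top_iff_lintegral_rpow_enorm_lt_top (by simpa using hp0) (by simp)).1 hML.2
    rwa [ENNReal.toReal_ofReal hp0.le] at this
  set F : ℂ × ℂ → ℂ := fun w => (‖w.1‖ ^ 2 : ℂ) * M w with hF
  have hFi : Integrable F bidiscMeasure := by
    refine ((hML.mono_exponent h2p).integrable (by norm_num)).bdd_mul (c := 1) (by fun_prop) ?_
    filter_upwards [ae_bidiscMeasure_norm_lt_one] with w hw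
    simpa using hw.1.le
  have hPF : bidiscProjection F =ᵐ[bidiscMeasure] G := by
    refine bidiscProjection_ae_eq hFi hGs hGm.aestronglyMeasurable hG2 ?_
    filter_upwards [ae_discMeasure_norm_lt_one,
      ae_lintegral_sq_fst_lt_top hGm.aestronglyMeasurable hG2] with ζ₂ h1 h2 w₁ hw hw0
    exact integral_discKernel_mul_sq_mul_add_radialAverage (hGs.fst ζ₂ h1) h2 hw hw0
  have hf : MemLp (hartogsDescent F) (ENNReal.ofReal p) (volume.restrict hartogsTriangle) :=
    memLp_ofReal_of_lintegral_lt_top hp0 (aestronglyMeasurable_hartogsDescent hFi.1)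
      ((lintegral_enorm_hartogsDescent_rpow_le hp hML.1).trans_lt hMp)
  have hcongr : bidiscProjection (bidiscLift (hartogsDescent F)) = bidiscProjection F := by
    funext w
    refine integral_congr_ae ?_
    filter_upwards [bidiscLift_hartogsDescent_ae_eq F] with ζ hζ
    rw [hζ]
  refine ⟨hartogsDescent F, hf, (hartogsBergmanProjection_ae_eq _).trans ?_⟩
  rw [hcongr]
  refine (hartogsDescent_congr_ae hPF).trans ?_
  filter_upwards [ae_restrict_mem isOpen_hartogsTriangle.measurableSet] with z hz
  exact hartogsDescent_bidiscLift hz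

/-- For `2 ≤ p < ∞` the Bergman projection is bounded and surjective from `L^p(ℍ)` to
`A^p(ℍ, δ₁^(p-2))`: the first part says that it maps `L^p(ℍ)` into that space with a norm bound,
the second one that every element of that space is the image of an element of `L^p(ℍ)`. -/
theorem theorem1p1 (p : ℝ) (hp : 2 ≤ p) :
    (∃ C : ℝ≥0, ∀ (f : ℂ × ℂ → ℂ)
        (hf : MemLp f (ENNReal.ofReal p) (volume.restrict hartogsTriangle)),
      ∃ g ∈ weightedBergmanSpace hartogsTriangle p (fun z => delta1 z ^ (p - 2)),
        hartogsBergmanProjection ((memLp_two_of_memLp hp hf).toLp f)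
            =ᵐ[volume.restrict hartogsTriangle] g ∧
          weightedLpNorm hartogsTriangle p (fun z => delta1 z ^ (p - 2)) g
            ≤ C * eLpNorm f (ENNReal.ofReal p) (volume.restrict hartogsTriangle)) ∧
    (∀ g ∈ weightedBergmanSpace hartogsTriangle p (fun z => delta1 z ^ (p - 2)),
      ∃ (f : ℂ × ℂ → ℂ) (hf : MemLp f (ENNReal.ofReal p) (volume.restrict hartogsTriangle)),
        hartogsBergmanProjection ((memLp_two_of_memLp hp hf).toLp f)
          =ᵐ[volume.restrict hartogsTriangle] g) :=
  ⟨exists_bound_hartogsBergmanProjection hp, fun _ hg => exists_hartogsBergmanProjection_eq hp hg⟩
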